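/- **Soundness of IPDEL.** Fix a set $\mathsf{Ag}$ of agents and a set $\mathsf{AtProp}$ of proposition letters. *Language.* Formulas are given by $$\varphi ::= p\mid\bot\mid\varphi\wedge\varphi\mid\varphi\vee\varphi\mid\varphi\to\varphi\mid\lozenge_i\varphi\mid\Box_i\varphi\mid\langle\mathcal E,e\rangle\varphi\mid[\mathcal E,e]\varphi\mid \textstyle\sum_{k=1}^n\alpha_k\mu_i(\varphi_k)\ge\beta ,$$ with real $\alpha_k,\beta$ and $n\ge 0$; $\top,\neg,\leftrightarrow$ are the usual abbreviations, and for linear terms $t,t'$ of one agent: $\beta\ge t$ is $-t\ge-\beta$; $t>\gamma$ is $\neg(\gamma\ge t)$; $t\ge t'$ is $t-t'\ge0$; $=$ is the conjunction of $\ge$ and $\le$; and, for a number $d$, $d\ge 0$ is the inequality $0\geq -d$ whose left side is the empty sum. Here $\mathcal E=(E,(\sim_i),(P_i),(\Phi,\prec),\mathsf{pre},\mathbf{sub})$ is an *event structure*: $E$ is finite and non-empty, $e\in E$, each $\sim_i$ is an equivalence relation on $E$, $P_i:E\to\,]0,1]$ sums to $1$ on each $\sim_i$-class, $\Phi$ is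 a finite set of formulas with a strict partial order $\prec$ such that $\phi\prec\psi$ implies $\vdash\phi\to\psi$ and distinct $\prec$-incomparable $\phi,\psi$ satisfy $\vdash\neg(\phi\wedge\psi)$, $\mathsf{pre}(\bullet\mid\phi)$ is a probability distribution on $E$ for each $\phi\in\Phi$ such that $\phi\prec\psi$ and $\mathsf{pre}(e\mid\phi)=0$ imply $\mathsf{pre}(e\mid\psi)=0$, and $\mathbf{sub}(e):\mathsf{AtProp}\to\{\text{formulas}\}$ moves only finitely many letters. Formulas, event structures and derivability $\vdash$ are defined by simultaneous induction. Put $\mathsf{pre}(e)=\bigvee\{\phi\in\Phi\mid\mathsf{pre}(e\mid\phi)\ne0\}$, let $\mathrm{mb}(\phi)$ be the set of $\prec$-maximal elements of $\{\sigma\in\Phi\mid\sigma\prec\phi\}$, and $\mu_i^\phi(\psi)=\mu_i(\psi\wedge\phi)-\sum_{\sigma\in\mathrm{mb}(\phi)}\mu_i(\psi\wedge\sigma)$. *Axiom schemes and rules* ($A,B,C,\varphi,\psi,\dots$ arbitrary formulas, $t$ a linear term): - H1 $A\to(B\to A)$; H2 $(A\to(B\to C))\to((A\to B)\to(A\to C))$;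 H3 $A\to(B\to A\wedge B)$; H4 $(A\to C)\to((B\to C)\to(A\vee B\to C))$; H5 $A\wedge B\to A$; H6 $A\wedge B\to B$; H7 $A\to A\vee B$; H8 $B\to A\vee B$; H9 $\bot\to A$. - M1 $A\to\lozenge_iA$; M2 $\Box_iA\to A$; M3 $\lozenge_i(A\vee B)\to\lozenge_iA\vee\lozenge_iB$; M4 $\Box_i(A\to B)\to(\Box_iA\to\Box_iB)$; M5 $\lozenge_iA\to\Box_i\lozenge_iA$; M6 $\lozenge_i\Box_iA\to\Box_iA$; M7 $\Box_i(A\to B)\to(\lozenge_iA\to\lozenge_iB)$; E $\lozenge_iA\vee\neg\lozenge_iA$. - N0 $t\ge t$; N1 $(t\ge\beta)\leftrightarrow(t+0\cdot\mu_i(\varphi)\ge\beta)$; N2 permutation of the summands of $t$ in $t\ge\beta$; N3 $(\sum\alpha_k\mu_i(\varphi_k)\ge\beta)\wedge(\sum\alpha'_k\mu_i(\varphi_k)\ge\beta')\to\sum(\alpha_k+\alpha_k')\mu_i(\varphi_k)\ge\beta+\beta'$; N4 $(t\ge\beta)\wedge(d\ge0)\to(d\cdot t\ge d\beta)$; N5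 $(t\ge\beta)\vee(\beta\ge t)$; N6 $(t\ge\beta)\to(t>\gamma)$ for $\gamma<\beta$. - P1 $\mu_i(\bot)=0$; P2 $\mu_i(\top)=1$; P3 $\mu_i(\varphi)+\mu_i(\psi)=\mu_i(\varphi\vee\psi)+\mu_i(\varphi\wedge\psi)$; P4 $[\Box_i(\varphi\to\psi)\wedge(\mu_i(\varphi)=\mu_i(\psi))]\leftrightarrow\Box_i(\psi\leftrightarrow\varphi)$; P5 $(t\ge\beta)\to\Box_i(t\ge\beta)$. - I1 $[\mathcal E,e]p\leftrightarrow(\mathsf{pre}(e)\to\mathbf{sub}(e)(p))$; I2 $\langle\mathcal E,e\rangle p\leftrightarrow\mathsf{pre}(e)\wedge\mathbf{sub}(e)(p)$; I3 $[\mathcal E,e]\top\leftrightarrow\top$; I4 $\langle\mathcal E,e\rangle\top\leftrightarrow\mathsf{pre}(e)$; I5 $[\mathcal E,e]\bot\leftrightarrow\neg\mathsf{pre}(e)$; I6 $\langle\mathcal E,e\rangle\bot\leftrightarrow\bot$; I7 $[\mathcal E,e](\varphi\wedge\psi)\leftrightarrow[\mathcal E,e]\varphi\wedge[\mathcal E,e]\psi$;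 I8 $\langle\mathcal E,e\rangle(\varphi\wedge\psi)\leftrightarrow\langle\mathcal E,e\rangle\varphi\wedge\langle\mathcal E,e\rangle\psi$; I9 $[\mathcal E,e](\varphi\vee\psi)\leftrightarrow(\mathsf{pre}(e)\to\langle\mathcal E,e\rangle\varphi\vee\langle\mathcal E,e\rangle\psi)$; I10 $\langle\mathcal E,e\rangle(\varphi\vee\psi)\leftrightarrow\langle\mathcal E,e\rangle\varphi\vee\langle\mathcal E,e\rangle\psi$; I11 $[\mathcal E,e](\varphi\to\psi)\leftrightarrow(\langle\mathcal E,e\rangle\varphi\to\langle\mathcal E,e\rangle\psi)$; I12 $\langle\mathcal E,e\rangle(\varphi\to\psi)\leftrightarrow\mathsf{pre}(e)\wedge(\langle\mathcal E,e\rangle\varphi\to\langle\mathcal E,e\rangle\psi)$; I13/I14 $[\mathcal E,e]\lozenge_i\psi\leftrightarrow(\mathsf{pre}(e)\to\bigvee_{e'\sim_ie}\lozenge_i\langle\mathcal E,e'\rangle\psi)$ and $\langle\mathcal E,e\rangle\lozenge_i\psi\leftrightarrow\mathsf{pre}(e)\wedge\bigvee_{e'\sim_ie}\lozenge_i\langle\mathcal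 E,e'\rangle\psi$; I15/I16 $[\mathcal E,e]\Box_i\psi\leftrightarrow(\mathsf{pre}(e)\to\bigwedge_{e'\sim_ie}\Box_i[\mathcal E,e']\psi)$ and $\langle\mathcal E,e\rangle\Box_i\psi\leftrightarrow\mathsf{pre}(e)\wedge\bigwedge_{e'\sim_ie}\Box_i[\mathcal E,e']\psi$; I17/I18 $[\mathcal E,e](\alpha\mu_i(\psi)\ge\beta)\leftrightarrow(\mathsf{pre}(e)\to(C+D\ge0))$ and $\langle\mathcal E,e\rangle(\alpha\mu_i(\psi)\ge\beta)\leftrightarrow\mathsf{pre}(e)\wedge(C+D\ge0)$, where $C=\sum_{e'\sim_ie,\ \phi\in\Phi}\alpha P_i(e')\mathsf{pre}(e'\mid\phi)\mu_i^\phi([\mathcal E,e']\psi)$ and $D=\sum_{e'\sim_ie,\ \phi\in\Phi}-\beta P_i(e')\mathsf{pre}(e'\mid\phi)\mu_i^\phi(\top)$. - Rules: modus ponens; from $\vdash A$ infer $\vdash\Box_iA$ and $\vdash[\mathcal E,e]A$; from $\vdash A\to B$ infer $\vdash\mu_i(A)\le\mu_i(B)$; from $\vdash A\leftrightarrow B$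 infer $\vdash\varphi\leftrightarrow\varphi'$, where the formula $\varphi'$ arises from the formula $\varphi$ by replacing some occurrences of $A$ by $B$. *Models.* An epistemic Heyting algebra $\mathbb A$ is a finite Heyting algebra with monotone operations $\lozenge_i,\Box_i$ such that $a\le\lozenge_ia$, $\Box_ia\le a$, $\lozenge_i(a\vee b)\le\lozenge_ia\vee\lozenge_ib$, $\Box_i(a\to b)\le\Box_ia\to\Box_ib$, $\lozenge_ia\le\Box_i\lozenge_ia$, $\lozenge_i\Box_ia\le\Box_ia$, $\Box_i(a\to b)\le\lozenge_ia\to\lozenge_ib$, $\lozenge_i\bot\le\bot$, $\top\le\Box_i\top$ and $\lozenge_ia\vee\neg\lozenge_ia=\top$. An element is $i$-minimal if it is a minimal non-$\bot$ fixed point of $\lozenge_i$; $\mathsf{Min}_i(\mathbb A)$ is the set of these. An $i$-measure is a monotone map $\mu_i:\mathsf{Min}_i(\mathbb A){\downarrow}\to\mathbb R_{\ge0}$ with $\mu_i(\bot)=0$ (if the domain is non-empty) and, for $a\in\mathsf{Min}_i(\mathbb A)$ and $b,c\le a$: $\mu_i(b\vee c)=\mu_i(b)+\mu_i(c)-\mu_i(b\wedge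 c)$, $\mu_i(b)<\mu_i(c)$ if $b<c$, and $\mu_i(a)=1$. An *APE-model* $\mathcal M=(\mathbb A,(\mu_i)_i,v)$ is an epistemic Heyting algebra with an $i$-measure for each $i\in\mathsf{Ag}$ and a valuation $v:\mathsf{AtProp}\to\mathbb A$. *Semantics.* $[\![\cdot]\!]_{\mathcal M}$ is $v$ on letters and commutes with $\bot,\wedge,\vee,\to,\lozenge_i,\Box_i$; $[\![\sum\alpha_k\mu_i(\varphi_k)\ge\beta]\!]_{\mathcal M}=\bigvee\{a\in\mathsf{Min}_i(\mathbb A)\mid\sum\alpha_k\mu_i([\![\varphi_k]\!]_{\mathcal M}\wedge a)\ge\beta\}$; $[\![\langle\mathcal E,e\rangle\varphi]\!]_{\mathcal M}=\overline{\mathsf{pre}}(e)\wedge g(e)$ and $[\![[\mathcal E,e]\varphi]\!]_{\mathcal M}=\overline{\mathsf{pre}}(e)\to g(e)$, where $\overline{\mathsf{pre}}(e)=\bigvee\{[\![\phi]\!]_{\mathcal M}\mid\phi\in\Phi,\ \mathsf{pre}(e\mid\phi)\ne0\}$ and $g\in\mathbb A^E$ is the representative below $\overline{\mathsf{pre}}$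 of the class $[\![\varphi]\!]_{\mathcal M^{\mathcal E}}$. The updated model $\mathcal M^{\mathcal E}$ has as algebra the quotient of $\mathbb A^E$ by $f\cong f'\iff f\wedge\overline{\mathsf{pre}}=f'\wedge\overline{\mathsf{pre}}$, with $\lozenge_i[f]=[\lozenge'_i(f\wedge\overline{\mathsf{pre}})]$, $\Box_i[f]=[\Box'_i(\overline{\mathsf{pre}}\to f)]$, where $(\lozenge'_if)(e)=\bigvee_{e'\sim_ie}\lozenge_if(e')$ and $(\Box'_if)(e)=\bigwedge_{e'\sim_ie}\Box_if(e')$; with valuation $p\mapsto[e\mapsto[\![\mathbf{sub}(e)(p)]\!]_{\mathcal M}]$; and with measures $\mu_i^{\mathcal E}(\bot)=0$ and, for $\bot\ne[g]\le[f]\in\mathsf{Min}_i$ and representatives $g,f\le\overline{\mathsf{pre}}$, $\mu_i^{\mathcal E}([g])=\mu'_i(g)/\mu'_i(f)$, where $\mu_i'(h)=\sum_{e\in E}\sum_{\phi\in\Phi}P_i(e)\,\mathsf{pre}(e\mid\phi)\big(\mu_i(h(e)\wedge[\![\phi]\!]_{\mathcal M})-\sum_{\sigma\in\mathrm{mb}(\phi)}\mu_i(h(e)\wedge[\![\sigma]\!]_{\mathcal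 M})\big)$. **Claim.** The axiomatization is sound with respect to APE-models: if $\vdash\varphi$, then $[\![\varphi]\!]_{\mathcal M}=\top$ for every APE-model $\mathcal M$. -/

import Mathlib

/-! # Intuitionistic probabilistic dynamic epistemic logic (IPDEL) -/

universe u v w

namespace IPDEL

/-! ## Finite epistemic Heyting algebras and measures -/

section Algebra

/-- Monadic Heyting algebras: the laws of the families `◇ᵢ = dia i` and `□ᵢ = box i`. -/
structure IsMonadic {Ag A : Type*} [HeytingAlgebra A] (dia box : Ag → A → A) : Prop where
  dia_mono : ∀ i, Monotone (dia i)
  box_mono : ∀ i, Monotone (box i)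
  m1 : ∀ i a, a ≤ dia i a
  m2 : ∀ i a, box i a ≤ a
  m3 : ∀ i a b, dia i (a ⊔ b) ≤ dia i a ⊔ dia i b
  m4 : ∀ i a b, box i (a ⇨ b) ≤ box i a ⇨ box i b
  m5 : ∀ i a, dia i a ≤ box i (dia i a)
  m6 : ∀ i a, dia i (box i a) ≤ box i a
  m7 : ∀ i a b, box i (a ⇨ b) ≤ dia i a ⇨ dia i b
  m8 : ∀ i, dia i ⊥ ≤ ⊥
  m9 : ∀ i, ⊤ ≤ box i ⊤

/-- Epistemic Heyting algebras are the finite monadic Heyting algebras that satisfy `(E)`. -/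
structure IsEpistemic {Ag A : Type*} [HeytingAlgebra A] (dia box : Ag → A → A) : Prop
    extends IsMonadic dia box where
  finite : Finite A
  e : ∀ i a, dia i a ⊔ (dia i a)ᶜ = ⊤

/-- `a` is an `i`-minimal element, where `d` is the operation `◇ᵢ`. -/
def IsMin {A : Type*} [HeytingAlgebra A] (d : A → A) (a : A) : Prop :=
  a ≠ ⊥ ∧ d a = a ∧ ∀ b, b < a → d b = b → b = ⊥

/-- `i`-premeasures. A partial function with domain the down-set generated by the `i`-minimal
elements is represented by a total function, about which only the values on that domain matter. -/
structure IsPremeasure {A : Type*} [HeytingAlgebra A] (d : A → A) (μ : A → ℝ) : Prop where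
  nonneg : ∀ a, IsMin d a → ∀ b, b ≤ a → 0 ≤ μ b
  mono : ∀ a, IsMin d a → ∀ b c, b ≤ c → c ≤ a → μ b ≤ μ c
  join : ∀ a, IsMin d a → ∀ b c, b ≤ a → c ≤ a → μ (b ⊔ c) = μ b + μ c - μ (b ⊓ c)
  bot : (∃ a, IsMin d a) → μ ⊥ = 0

/-- `i`-measures. -/
structure IsMeasure {A : Type*} [HeytingAlgebra A] (d : A → A) (μ : A → ℝ) : Prop
    extends IsPremeasure d μ where
  strict : ∀ a, IsMin d a → ∀ b c, b < c → c ≤ a → μ b < μ c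
  one : ∀ a, IsMin d a → μ a = 1

end Algebra

/-! ## The pseudo-quotient of a Heyting algebra -/

section PseudoQuotient

variable {A : Type*} [HeytingAlgebra A]

/-- `b ≅ₐ c` iff `b ⊓ a = c ⊓ a`. -/
def pqSetoid (a : A) : Setoid A where
  r b c := b ⊓ a = c ⊓ a
  iseqv := ⟨fun _ => rfl, fun h => h.symm, fun h h' => h.trans h'⟩

/-- The quotient of `A` by `≅ₐ`. -/
def PQ (a : A) : Type _ := Quotient (pqSetoid a)

/-- The class of an element. -/
def PQ.mk (a b : A) : PQ a := Quotient.mk (pqSetoid a) b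

/-- The map `ι : [g] ↦ g ⊓ a`. -/
def PQ.iota (a : A) (q : PQ a) : A :=
  Quotient.lift (s := pqSetoid a) (fun b => b ⊓ a) (fun _ _ h => h) q

theorem PQ.iota_mk (a b : A) : PQ.iota a (PQ.mk a b) = b ⊓ a := rfl

theorem PQ.mk_eq {a b c : A} (h : b ⊓ a = c ⊓ a) : PQ.mk a b = PQ.mk a c :=
  Quotient.sound (s := pqSetoid a) h

theorem PQ.mk_iota (a : A) (q : PQ a) : PQ.mk a (PQ.iota a q) = q := by
  induction q using Quotient.ind with
  | _ b => exact PQ.mk_eq (inf_assoc b a a |>.trans (by rw [inf_idem]))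

theorem PQ.iota_inj {a : A} {q r : PQ a} (h : PQ.iota a q = PQ.iota a r) : q = r := by
  rw [← PQ.mk_iota a q, ← PQ.mk_iota a r, h]

theorem PQ.iota_le (a : A) (q : PQ a) : PQ.iota a q ≤ a := by
  induction q using Quotient.ind with
  | _ b => exact inf_le_right

instance PQ.instFinite [Finite A] (a : A) : Finite (PQ a) :=
  inferInstanceAs (Finite (Quotient (pqSetoid a)))

/-- All operations are those of `A`, applied to representatives. -/
instance PQ.instHeyting (a : A) : HeytingAlgebra (PQ a) where
  le q r := PQ.iota a q ≤ PQ.iota a r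
  le_refl _ := le_rfl
  le_trans _ _ _ h h' := le_trans h h'
  le_antisymm _ _ h h' := PQ.iota_inj (le_antisymm h h')
  sup q r := PQ.mk a (PQ.iota a q ⊔ PQ.iota a r)
  inf q r := PQ.mk a (PQ.iota a q ⊓ PQ.iota a r)
  top := PQ.mk a ⊤
  bot := PQ.mk a ⊥
  himp q r := PQ.mk a (PQ.iota a q ⇨ PQ.iota a r)
  compl q := PQ.mk a (PQ.iota a q)ᶜ
  le_sup_left q r := le_inf le_sup_left (PQ.iota_le a q)
  le_sup_right q r := le_inf le_sup_right (PQ.iota_le a r)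
  sup_le q r s h h' := le_trans inf_le_left (sup_le h h')
  inf_le_left q r := le_trans inf_le_left inf_le_left
  inf_le_right q r := le_trans inf_le_left inf_le_right
  le_inf q r s h h' := le_inf (le_inf h h') (PQ.iota_le a q)
  le_top q := le_inf le_top (PQ.iota_le a q)
  bot_le q := le_trans inf_le_left bot_le
  le_himp_iff q r s := by
    change PQ.iota a q ≤ (PQ.iota a r ⇨ PQ.iota a s) ⊓ a ↔
      (PQ.iota a q ⊓ PQ.iota a r) ⊓ a ≤ PQ.iota a s
    rw [le_inf_iff, le_himp_iff]
    constructor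
    · exact fun h => le_trans inf_le_left h.1
    · refine fun h => ⟨le_trans (le_inf le_rfl ?_) h, PQ.iota_le a q⟩
      exact le_trans inf_le_left (PQ.iota_le a q)
  himp_bot q := PQ.mk_eq (by
    change (PQ.iota a q ⇨ ⊥ ⊓ a) ⊓ a = (PQ.iota a q)ᶜ ⊓ a
    rw [bot_inf_eq, himp_bot])

/-- `◇ᵢᵃ [b] = [◇ᵢ (b ⊓ a)]`. -/
def PQ.dia (a : A) (d : A → A) (q : PQ a) : PQ a :=
  Quotient.lift (s := pqSetoid a) (fun b => PQ.mk a (d (b ⊓ a)))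
    (fun _ _ h => congrArg (fun x => PQ.mk a (d x)) h) q

/-- `□ᵢᵃ [b] = [□ᵢ (a ⇨ b)]`. -/
def PQ.box (a : A) (bx : A → A) (q : PQ a) : PQ a :=
  Quotient.lift (s := pqSetoid a) (fun b => PQ.mk a (bx (a ⇨ b)))
    (fun b c h => by
      have h' : a ⇨ b = a ⇨ c := by
        have key : ∀ x : A, a ⇨ x = a ⇨ (x ⊓ a) := fun x => by
          rw [himp_inf_distrib, himp_self, inf_top_eq]
        rw [key b, key c]
        exact congrArg (fun x => a ⇨ x) h
      exact congrArg (fun x => PQ.mk a (bx x)) h') q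

end PseudoQuotient

/-! ## Event structures: the part that does not mention formulas -/

/-- The events are `Fin n` and the elements of `Φ` are indexed by `Fin m`. The relation `prec`
is the strict order on (the index set of) `Φ`, and `compat` is the compatibility of the
precondition map with it. -/
structure EventFrame (Ag : Type*) where
  n : ℕ
  m : ℕ
  nonempty : 0 < n
  rel : Ag → Fin n → Fin n → Prop
  rel_equiv : ∀ i, Equivalence (rel i)
  P : Ag → Fin n → ℝ
  P_pos : ∀ i e, 0 < P i e
  P_sum : ∀ i e, (open scoped Classical in ∑ e' with rel i e' e, P i e') = 1
  prec : Fin m → Fin m → Prop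
  prec_irrefl : ∀ k, ¬ prec k k
  prec_trans : ∀ k l o, prec k l → prec l o → prec k o
  pre : Fin n → Fin m → ℝ
  pre_nonneg : ∀ e k, 0 ≤ pre e k
  pre_sum : ∀ k, ∑ e, pre e k = 1
  compat : ∀ e k l, prec k l → pre e k = 0 → pre e l = 0

/-- `mb(k)`: the maximal elements strictly below `k`. -/
noncomputable def EventFrame.mb {Ag : Type*} (F : EventFrame Ag) (k : Fin F.m) :
    Finset (Fin F.m) :=
  open scoped Classical in
  Finset.univ.filter fun l => F.prec l k ∧ ∀ o, F.prec o k → ¬ F.prec l o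

/-! ## Formulas -/

/-- Formulas. In the dynamic modalities `⟨𝓔, e⟩ φ` and `[𝓔, e] φ` the event structure `𝓔` is given
by its frame, its family `Φ` of formulas and its substitution map; `prob i n α φ β` is the formula
`∑ₖ αₖ μᵢ(φₖ) ≥ β`. -/
inductive Formula (Ag : Type*) (At : Type*) where
  | atom (p : At)
  | bot
  | and (φ ψ : Formula Ag At)
  | or (φ ψ : Formula Ag At)
  | imp (φ ψ : Formula Ag At)
  | dia (i : Ag) (φ : Formula Ag At)
  | box (i : Ag) (φ : Formula Ag At)
  | evDia (F : EventFrame Ag) (Φ : Fin F.m → Formula Ag At)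
      (sub : Fin F.n → At → Formula Ag At) (e : Fin F.n) (φ : Formula Ag At)
  | evBox (F : EventFrame Ag) (Φ : Fin F.m → Formula Ag At)
      (sub : Fin F.n → At → Formula Ag At) (e : Fin F.n) (φ : Formula Ag At)
  | prob (i : Ag) (n : ℕ) (α : Fin n → ℝ) (φ : Fin n → Formula Ag At) (β : ℝ)

/-- Event structures over the language (the conditions that involve formulas and derivability
are in `WFEvent` below). -/
structure EventStr (Ag : Type*) (At : Type*) where
  frame : EventFrame Ag
  Φ : Fin frame.m → Formula Ag At
  sub : Fin frame.n → At → Formula Ag At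

namespace Formula

variable {Ag At : Type*}

/-- `⊤` -/
def top : Formula Ag At := imp bot bot

/-- `¬ φ` -/
def neg (φ : Formula Ag At) : Formula Ag At := imp φ bot

/-- `φ ↔ ψ` -/
def iff (φ ψ : Formula Ag At) : Formula Ag At := and (imp φ ψ) (imp ψ φ)

/-- finite disjunction -/
def bigOr : List (Formula Ag At) → Formula Ag At
  | [] => bot
  | φ :: l => or φ (bigOr l)

/-- finite conjunction -/
def bigAnd : List (Formula Ag At) → Formula Ag At
  | [] => top
  | φ :: l => and φ (bigAnd l)

/-- `⟨𝓔, e⟩ φ` -/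
def dDia (E : EventStr Ag At) (e : Fin E.frame.n) (φ : Formula Ag At) : Formula Ag At :=
  evDia E.frame E.Φ E.sub e φ

/-- `[𝓔, e] φ` -/
def dBox (E : EventStr Ag At) (e : Fin E.frame.n) (φ : Formula Ag At) : Formula Ag At :=
  evBox E.frame E.Φ E.sub e φ

end Formula

/-! ### Linear terms `∑ₖ αₖ μᵢ(φₖ)` and derived inequalities -/

/-- The linear term `∑ₖ αₖ μᵢ(φₖ)`. -/
structure LTerm (Ag : Type*) (At : Type*) where
  n : ℕ
  coeff : Fin n → ℝ
  arg : Fin n → Formula Ag At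

namespace LTerm

variable {Ag At : Type*}

/-- the empty sum -/
def zero : LTerm Ag At := ⟨0, Fin.elim0, Fin.elim0⟩

/-- `α μ(φ)` -/
def single (α : ℝ) (φ : Formula Ag At) : LTerm Ag At := ⟨1, fun _ => α, fun _ => φ⟩

/-- `μ(φ)` -/
def mu (φ : Formula Ag At) : LTerm Ag At := single 1 φ

/-- `t + t'` -/
def add (t t' : LTerm Ag At) : LTerm Ag At :=
  ⟨t.n + t'.n, Fin.append t.coeff t'.coeff, Fin.append t.arg t'.arg⟩

/-- `d · t` -/
def smul (d : ℝ) (t : LTerm Ag At) : LTerm Ag At := ⟨t.n, fun k => d * t.coeff k, t.arg⟩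

/-- `- t` -/
def neg (t : LTerm Ag At) : LTerm Ag At := smul (-1) t

/-- finite sums of terms -/
def bigSum : List (LTerm Ag At) → LTerm Ag At
  | [] => zero
  | t :: l => add t (bigSum l)

/-- `t ≥ β` -/
def ge (i : Ag) (t : LTerm Ag At) (β : ℝ) : Formula Ag At := .prob i t.n t.coeff t.arg β

/-- `β ≥ t`, i.e. `- t ≥ - β` -/
def le (i : Ag) (t : LTerm Ag At) (β : ℝ) : Formula Ag At := ge i (neg t) (-β)

/-- `t > γ`, i.e. `¬ (γ ≥ t)` -/
def gt (i : Ag) (t : LTerm Ag At) (γ : ℝ) : Formula Ag At := .neg (le i t γ)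

/-- `t = β` -/
def eq (i : Ag) (t : LTerm Ag At) (β : ℝ) : Formula Ag At := .and (ge i t β) (le i t β)

/-- `t ≥ t'`, i.e. `t - t' ≥ 0` -/
def geT (i : Ag) (t t' : LTerm Ag At) : Formula Ag At := ge i (add t (neg t')) 0

/-- `t = t'` -/
def eqT (i : Ag) (t t' : LTerm Ag At) : Formula Ag At := .and (geT i t t') (geT i t' t)

/-- the inequality `d ≥ 0` for a number `d`, i.e. (the empty sum) `≥ - d` -/
def constNonneg (i : Ag) (d : ℝ) : Formula Ag At := ge i zero (-d)

end LTerm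

namespace EventStr

variable {Ag At : Type*}

/-- The formula `pre(e)`: the disjunction of the `φ ∈ Φ` with `pre(e ∣ φ) ≠ 0`. -/
noncomputable def preF (E : EventStr Ag At) (e : Fin E.frame.n) : Formula Ag At :=
  open scoped Classical in
  Formula.bigOr (((List.finRange E.frame.m).filter fun k => E.frame.pre e k ≠ 0).map E.Φ)

/-- The events `e' ∼ᵢ e`, as a list. -/
noncomputable def cell (E : EventStr Ag At) (i : Ag) (e : Fin E.frame.n) :
    List (Fin E.frame.n) :=
  open scoped Classical in
  (List.finRange E.frame.n).filter fun e' => E.frame.rel i e' e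

/-- The term `μ^φ(ψ) = μ(ψ ∧ φ) - ∑_{σ ∈ mb(φ)} μ(ψ ∧ σ)` for `φ = Φ k`. -/
noncomputable def muT (E : EventStr Ag At) (k : Fin E.frame.m) (ψ : Formula Ag At) :
    LTerm Ag At :=
  open scoped Classical in
  LTerm.add (LTerm.mu (.and ψ (E.Φ k)))
    (LTerm.neg (LTerm.bigSum (((List.finRange E.frame.m).filter fun l => l ∈ E.frame.mb k).map
      fun l => LTerm.mu (.and ψ (E.Φ l)))))

/-- The term `∑_{e' ∼ᵢ e, φ ∈ Φ} c · Pᵢ(e') · pre(e' ∣ φ) · μ^φ(χ(e'))`. -/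
noncomputable def sumT (E : EventStr Ag At) (i : Ag) (e : Fin E.frame.n) (c : ℝ)
    (χ : Fin E.frame.n → Formula Ag At) : LTerm Ag At :=
  LTerm.bigSum ((E.cell i e).map fun e' =>
    LTerm.bigSum ((List.finRange E.frame.m).map fun k =>
      LTerm.smul (c * E.frame.P i e' * E.frame.pre e' k) (E.muT k (χ e'))))

/-- The formula `C + D ≥ 0` of the reduction axioms for `α μᵢ(ψ) ≥ β`. -/
noncomputable def redF (E : EventStr Ag At) (i : Ag) (e : Fin E.frame.n) (α β : ℝ)
    (ψ : Formula Ag At) : Formula Ag At :=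
  LTerm.ge i (LTerm.add (E.sumT i e α fun e' => .dBox E e' ψ)
    (E.sumT i e (-β) fun _ => .top)) 0

end EventStr

/-! ## The axiomatization -/

open Formula in
/-- The axiom schemes. -/
inductive Ax {Ag At : Type*} : Formula Ag At → Prop
  -- intuitionistic propositional logic
  | h1 (A B) : Ax (imp A (imp B A))
  | h2 (A B C) : Ax (imp (imp A (imp B C)) (imp (imp A B) (imp A C)))
  | h3 (A B) : Ax (imp A (imp B (and A B)))
  | h4 (A B C) : Ax (imp (imp A C) (imp (imp B C) (imp (or A B) C)))
  | h5 (A B) : Ax (imp (and A B) A)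
  | h6 (A B) : Ax (imp (and A B) B)
  | h7 (A B) : Ax (imp A (or A B))
  | h8 (A B) : Ax (imp B (or A B))
  | h9 (A) : Ax (imp bot A)
  -- static modalities
  | m1 (i A) : Ax (imp A (dia i A))
  | m2 (i A) : Ax (imp (box i A) A)
  | m3 (i A B) : Ax (imp (dia i (or A B)) (or (dia i A) (dia i B)))
  | m4 (i A B) : Ax (imp (box i (imp A B)) (imp (box i A) (box i B)))
  | m5 (i A) : Ax (imp (dia i A) (box i (dia i A)))
  | m6 (i A) : Ax (imp (dia i (box i A)) (box i A))
  | m7 (i A B) : Ax (imp (box i (imp A B)) (imp (dia i A) (dia i B)))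
  | e (i A) : Ax (or (dia i A) (neg (dia i A)))
  -- inequalities
  | n0 (i) (t : LTerm Ag At) : Ax (LTerm.geT i t t)
  | n1 (i) (t : LTerm Ag At) (β : ℝ) (φ) :
      Ax (iff (LTerm.ge i t β) (LTerm.ge i (t.add (.single 0 φ)) β))
  | n2 (i) (n : ℕ) (α : Fin n → ℝ) (φ : Fin n → Formula Ag At) (β : ℝ)
      (σ : Equiv.Perm (Fin n)) :
      Ax (imp (prob i n α φ β) (prob i n (fun k => α (σ k)) (fun k => φ (σ k)) β))
  | n3 (i) (n : ℕ) (α α' : Fin n → ℝ) (φ : Fin n → Formula Ag At) (β β' : ℝ) :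
      Ax (imp (and (prob i n α φ β) (prob i n α' φ β'))
        (prob i n (fun k => α k + α' k) φ (β + β')))
  | n4 (i) (t : LTerm Ag At) (β d : ℝ) :
      Ax (imp (and (LTerm.ge i t β) (LTerm.constNonneg i d))
        (LTerm.ge i (t.smul d) (d * β)))
  | n5 (i) (t : LTerm Ag At) (β : ℝ) : Ax (or (LTerm.ge i t β) (LTerm.le i t β))
  | n6 (i) (t : LTerm Ag At) (β γ : ℝ) (h : γ < β) :
      Ax (imp (LTerm.ge i t β) (LTerm.gt i t γ))
  -- probabilities
  | p1 (i) : Ax (LTerm.eq i (.mu bot) 0)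
  | p2 (i) : Ax (LTerm.eq i (.mu top) 1)
  | p3 (i φ ψ) : Ax (LTerm.eqT i ((LTerm.mu φ).add (.mu ψ))
      ((LTerm.mu (or φ ψ)).add (.mu (and φ ψ))))
  | p4 (i φ ψ) : Ax (iff (and (box i (imp φ ψ)) (LTerm.eqT i (.mu φ) (.mu ψ)))
      (box i (iff ψ φ)))
  | p5 (i) (n : ℕ) (α : Fin n → ℝ) (φ : Fin n → Formula Ag At) (β : ℝ) :
      Ax (imp (prob i n α φ β) (box i (prob i n α φ β)))
  -- reduction axioms
  | i1 (E : EventStr Ag At) (e p) :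
      Ax (iff (dBox E e (atom p)) (imp (E.preF e) (E.sub e p)))
  | i2 (E : EventStr Ag At) (e p) :
      Ax (iff (dDia E e (atom p)) (and (E.preF e) (E.sub e p)))
  | i3 (E : EventStr Ag At) (e) : Ax (iff (dBox E e top) top)
  | i4 (E : EventStr Ag At) (e) : Ax (iff (dDia E e top) (E.preF e))
  | i5 (E : EventStr Ag At) (e) : Ax (iff (dBox E e bot) (neg (E.preF e)))
  | i6 (E : EventStr Ag At) (e) : Ax (iff (dDia E e bot) bot)
  | i7 (E : EventStr Ag At) (e φ ψ) :
      Ax (iff (dBox E e (and φ ψ)) (and (dBox E e φ) (dBox E e ψ)))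
  | i8 (E : EventStr Ag At) (e φ ψ) :
      Ax (iff (dDia E e (and φ ψ)) (and (dDia E e φ) (dDia E e ψ)))
  | i9 (E : EventStr Ag At) (e φ ψ) :
      Ax (iff (dBox E e (or φ ψ)) (imp (E.preF e) (or (dDia E e φ) (dDia E e ψ))))
  | i10 (E : EventStr Ag At) (e φ ψ) :
      Ax (iff (dDia E e (or φ ψ)) (or (dDia E e φ) (dDia E e ψ)))
  | i11 (E : EventStr Ag At) (e φ ψ) :
      Ax (iff (dBox E e (imp φ ψ)) (imp (dDia E e φ) (dDia E e ψ)))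
  | i12 (E : EventStr Ag At) (e φ ψ) :
      Ax (iff (dDia E e (imp φ ψ)) (and (E.preF e) (imp (dDia E e φ) (dDia E e ψ))))
  | i13 (E : EventStr Ag At) (e i ψ) :
      Ax (iff (dBox E e (dia i ψ))
        (imp (E.preF e) (bigOr ((E.cell i e).map fun e' => dia i (dDia E e' ψ)))))
  | i14 (E : EventStr Ag At) (e i ψ) :
      Ax (iff (dDia E e (dia i ψ))
        (and (E.preF e) (bigOr ((E.cell i e).map fun e' => dia i (dDia E e' ψ)))))
  | i15 (E : EventStr Ag At) (e i ψ) :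
      Ax (iff (dBox E e (box i ψ))
        (imp (E.preF e) (bigAnd ((E.cell i e).map fun e' => box i (dBox E e' ψ)))))
  | i16 (E : EventStr Ag At) (e i ψ) :
      Ax (iff (dDia E e (box i ψ))
        (and (E.preF e) (bigAnd ((E.cell i e).map fun e' => box i (dBox E e' ψ)))))
  | i17 (E : EventStr Ag At) (e i ψ) (α β : ℝ) :
      Ax (iff (dBox E e (LTerm.ge i (.single α ψ) β))
        (imp (E.preF e) (E.redF i e α β ψ)))
  | i18 (E : EventStr Ag At) (e i ψ) (α β : ℝ) :
      Ax (iff (dDia E e (LTerm.ge i (.single α ψ) β))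
        (and (E.preF e) (E.redF i e α β ψ)))

/-- `Repl A B φ φ'`: the formula `φ'` results from `φ` by replacing some occurrences of `A` by
`B`; occurrences inside event structures are included. -/
inductive Repl {Ag At : Type*} (A B : Formula Ag At) : Formula Ag At → Formula Ag At → Prop
  | here : Repl A B A B
  | refl (φ) : Repl A B φ φ
  | and {φ φ' ψ ψ'} : Repl A B φ φ' → Repl A B ψ ψ' → Repl A B (.and φ ψ) (.and φ' ψ')
  | or {φ φ' ψ ψ'} : Repl A B φ φ' → Repl A B ψ ψ' → Repl A B (.or φ ψ) (.or φ' ψ')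
  | imp {φ φ' ψ ψ'} : Repl A B φ φ' → Repl A B ψ ψ' → Repl A B (.imp φ ψ) (.imp φ' ψ')
  | dia {i φ φ'} : Repl A B φ φ' → Repl A B (.dia i φ) (.dia i φ')
  | box {i φ φ'} : Repl A B φ φ' → Repl A B (.box i φ) (.box i φ')
  | evDia {F : EventFrame Ag} {Φ Φ' sub sub' e φ φ'} :
      (∀ k, Repl A B (Φ k) (Φ' k)) → (∀ e' p, Repl A B (sub e' p) (sub' e' p)) →
      Repl A B φ φ' → Repl A B (.evDia F Φ sub e φ) (.evDia F Φ' sub' e φ')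
  | evBox {F : EventFrame Ag} {Φ Φ' sub sub' e φ φ'} :
      (∀ k, Repl A B (Φ k) (Φ' k)) → (∀ e' p, Repl A B (sub e' p) (sub' e' p)) →
      Repl A B φ φ' → Repl A B (.evBox F Φ sub e φ) (.evBox F Φ' sub' e φ')
  | prob {i n α φ φ' β} : (∀ k, Repl A B (φ k) (φ' k)) →
      Repl A B (.prob i n α φ β) (.prob i n α φ' β)

mutual

/-- The formulas of the language: every event structure that occurs satisfies `WFEvent`. -/
inductive WF {Ag : Type u} {At : Type v} : Formula Ag At → Prop
  | atom (p) : WF (.atom p)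
  | bot : WF .bot
  | and {φ ψ} : WF φ → WF ψ → WF (.and φ ψ)
  | or {φ ψ} : WF φ → WF ψ → WF (.or φ ψ)
  | imp {φ ψ} : WF φ → WF ψ → WF (.imp φ ψ)
  | dia {i φ} : WF φ → WF (.dia i φ)
  | box {i φ} : WF φ → WF (.box i φ)
  | evDia {F Φ sub e φ} : WFEvent ⟨F, Φ, sub⟩ → WF φ → WF (.evDia F Φ sub e φ)
  | evBox {F Φ sub e φ} : WFEvent ⟨F, Φ, sub⟩ → WF φ → WF (.evBox F Φ sub e φ)
  | prob {i n α β} {φ : Fin n → Formula Ag At} : (∀ k, WF (φ k)) → WF (.prob i n α φ β)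

/-- The event structures over the language: `Φ` is a finite set of formulas on which `prec`
is an order by derivable implication and of which incomparable members contradict each other;
every substitution moves only finitely many proposition letters. -/
inductive WFEvent {Ag : Type u} {At : Type v} : EventStr Ag At → Prop
  | mk (E : EventStr Ag At) :
      (∀ k, WF (E.Φ k)) →
      (∀ e p, WF (E.sub e p)) →
      Function.Injective E.Φ →
      (∀ e, {p | E.sub e p ≠ .atom p}.Finite) →
      (∀ k l, E.frame.prec k l → Provable (.imp (E.Φ k) (E.Φ l))) →
      (∀ k l, k ≠ l → ¬ E.frame.prec k l → ¬ E.frame.prec l k →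
        Provable (.neg (.and (E.Φ k) (E.Φ l)))) →
      WFEvent E

/-- Derivability `⊢ φ` in IPDEL. -/
inductive Provable {Ag : Type u} {At : Type v} : Formula Ag At → Prop
  | ax {φ} : Ax φ → WF φ → Provable φ
  | mp {A B} : Provable (.imp A B) → Provable A → Provable B
  | nec {A} (i) : Provable A → Provable (.box i A)
  | necE {A} (E : EventStr Ag At) (e) : WFEvent E → Provable A → Provable (.dBox E e A)
  | subMu {A B} (i) : Provable (.imp A B) → Provable (LTerm.geT i (.mu B) (.mu A))
  | subEq {A B φ φ'} : Provable (.iff A B) → WF φ → WF φ' → Repl A B φ φ' →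
      Provable (.iff φ φ')

end

/-! ## Models, updates and the interpretation of formulas -/

/-- The data of an algebraic model; `mu i` is a total function that extends the partial
function `μᵢ`. -/
structure Model (Ag : Type u) (At : Type v) where
  carrier : Type w
  [heyting : HeytingAlgebra carrier]
  [finite : Finite carrier]
  dia : Ag → carrier → carrier
  box : Ag → carrier → carrier
  mu : Ag → carrier → ℝ
  val : At → carrier

attribute [instance] Model.heyting Model.finite

namespace Model

variable {Ag : Type u} {At : Type v}

/-- APE-models. -/
structure IsAPE (M : Model.{u, v, w} Ag At) : Prop where
  epistemic : IsEpistemic M.dia M.box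
  measure : ∀ i, IsMeasure (M.dia i) (M.mu i)

section Update

variable (M : Model.{u, v, w} Ag At) (F : EventFrame Ag) (Φ : Fin F.m → M.carrier)

/-- `◇'ᵢ` on the product algebra. -/
noncomputable def prodDia (i : Ag) (f : Fin F.n → M.carrier) : Fin F.n → M.carrier :=
  open scoped Classical in
  fun e => (Finset.univ.filter fun e' => F.rel i e' e).sup fun e' => M.dia i (f e')

/-- `□'ᵢ` on the product algebra. -/
noncomputable def prodBox (i : Ag) (f : Fin F.n → M.carrier) : Fin F.n → M.carrier :=
  open scoped Classical in
  fun e => (Finset.univ.filter fun e' => F.rel i e' e).inf fun e' => M.box i (f e')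

/-- The element `pre` of the product algebra. -/
noncomputable def preBar : Fin F.n → M.carrier :=
  open scoped Classical in
  fun e => (Finset.univ.filter fun k => F.pre e k ≠ 0).sup Φ

/-- `μᵢᵃ` for `a = Φ k`. -/
noncomputable def muPart (i : Ag) (k : Fin F.m) (x : M.carrier) : ℝ :=
  M.mu i (x ⊓ Φ k) - ∑ l ∈ F.mb k, M.mu i (x ⊓ Φ l)

/-- `μ'ᵢ` on the product algebra. -/
noncomputable def muProd (i : Ag) (f : Fin F.n → M.carrier) : ℝ :=
  ∑ e, ∑ k, F.P i e * muPart M F Φ i k (f e) * F.pre e k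

/-- `◇ᵢ` of the updated algebra. -/
noncomputable def updDia (i : Ag) : PQ (preBar M F Φ) → PQ (preBar M F Φ) :=
  PQ.dia (preBar M F Φ) (prodDia M F i)

/-- `□ᵢ` of the updated algebra. -/
noncomputable def updBox (i : Ag) : PQ (preBar M F Φ) → PQ (preBar M F Φ) :=
  PQ.box (preBar M F Φ) (prodBox M F i)

/-- `μᵢ` of the updated algebra: `[g] ↦ μ'ᵢ(g) / μ'ᵢ(f)`, with `[f]` the `i`-minimal element
above `[g]`, and with the value `0` at `⊥`. The representatives are those below `pre`. -/
noncomputable def updMu (i : Ag) (q : PQ (preBar M F Φ)) : ℝ :=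
  open scoped Classical in
  if q = ⊥ then 0
  else if h : ∃ f, IsMin (updDia M F Φ i) f ∧ q ≤ f then
    muProd M F Φ i (PQ.iota _ q) / muProd M F Φ i (PQ.iota _ h.choose)
  else 0

/-- The updated model, given the interpretations of the formulas in `Φ` and in the
substitution map. -/
noncomputable def update (s : Fin F.n → At → M.carrier) : Model.{u, v, w} Ag At where
  carrier := PQ (preBar M F Φ)
  dia := updDia M F Φ
  box := updBox M F Φ
  mu := updMu M F Φ
  val p := PQ.mk (preBar M F Φ) fun e => s e p

end Update

/-- The interpretation of formulas. -/
noncomputable def interp : Formula Ag At → (M : Model.{u, v, w} Ag At) → M.carrier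
  | .atom p, M => M.val p
  | .bot, _ => ⊥
  | .and φ ψ, M => interp φ M ⊓ interp ψ M
  | .or φ ψ, M => interp φ M ⊔ interp ψ M
  | .imp φ ψ, M => interp φ M ⇨ interp ψ M
  | .dia i φ, M => M.dia i (interp φ M)
  | .box i φ, M => M.box i (interp φ M)
  | .evDia F Φ sub e φ, M =>
      preBar M F (fun k => interp (Φ k) M) e ⊓
        PQ.iota _ (interp φ
          (update M F (fun k => interp (Φ k) M) fun e' p => interp (sub e' p) M)) e
  | .evBox F Φ sub e φ, M =>
      preBar M F (fun k => interp (Φ k) M) e ⇨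
        PQ.iota _ (interp φ
          (update M F (fun k => interp (Φ k) M) fun e' p => interp (sub e' p) M)) e
  | .prob i n α φ β, M =>
      (Set.toFinite {a : M.carrier | IsMin (M.dia i) a ∧
        β ≤ ∑ k : Fin n, α k * M.mu i (interp (φ k) M ⊓ a)}).toFinset.sup id

end Model

end IPDEL

-- Soundness is an induction over the three simultaneous predicates: well-formed formulas and event
-- structures satisfy semantic side conditions, and derivable formulas are true in every APE-model.
-- Quantifying over all models at once is essential, because a dynamic modality evaluates its
-- argument in the updated model. The crux is therefore `IsAPE.update`: an update by a coherent
-- event structure is again an APE-model.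
--
-- For the algebra, the product and the pseudo-quotient each preserve the epistemic laws. For the
-- measures, coherence makes the `≺`-maximal formulas below a given one pairwise disjoint, so
-- `muPart` is the measure of a difference (`muPart_eq`) and is monotone. Strictness comes from a
-- `≺`-minimal formula that detects the difference (`exists_muPart_lt`). Minimal elements of the
-- updated algebra are one minimal element of the old algebra spread over one cell
-- (`exists_eq_cellClass`), so the weighted sum `muProd` may be computed below one old minimal
-- element, and it is positive there and can be normalized.
--
-- The static axioms rest on the minimal elements being pairwise disjoint with join `⊤`: an
-- inequality formula is the join of those at which it holds, so arithmetic may be done at each of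
-- them separately. The reduction axioms compare representatives below the precondition. For
-- probabilities (`ev_ge`) one clears the positive denominator in the normalized measure, which
-- turns the updated inequality into `C + D ≥ 0`.

namespace IPDEL

-- Fixed points and minimal elements of epistemic Heyting algebras.

section Epistemic

variable {Ag A : Type*} [HeytingAlgebra A] {dia box : Ag → A → A}

namespace IsMonadic

theorem dia_bot (h : IsMonadic dia box) (i : Ag) : dia i ⊥ = ⊥ := le_bot_iff.1 (h.m8 i)

theorem box_top (h : IsMonadic dia box) (i : Ag) : box i ⊤ = ⊤ := top_le_iff.1 (h.m9 i)

theorem box_dia (h : IsMonadic dia box) (i : Ag) (a : A) : box i (dia i a) = dia i a :=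
  le_antisymm (h.m2 i _) (h.m5 i a)

theorem dia_dia (h : IsMonadic dia box) (i : Ag) (a : A) : dia i (dia i a) = dia i a := by
  refine le_antisymm ?_ (h.m1 i _)
  have := h.m6 i (dia i a)
  rwa [h.box_dia] at this

theorem dia_box (h : IsMonadic dia box) (i : Ag) (a : A) : dia i (box i a) = box i a :=
  le_antisymm (h.m6 i a) (h.m1 i _)

theorem box_of_fixed (h : IsMonadic dia box) {i : Ag} {a : A} (ha : dia i a = a) :
    box i a = a := by
  rw [← ha, h.box_dia]

theorem le_box_iff (h : IsMonadic dia box) {i : Ag} {a b : A} (ha : dia i a = a) :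
    a ≤ box i b ↔ a ≤ b :=
  ⟨fun hb => hb.trans (h.m2 i b), fun hb => (h.box_of_fixed ha).ge.trans (h.box_mono i hb)⟩

theorem dia_sup (h : IsMonadic dia box) (i : Ag) (a b : A) :
    dia i (a ⊔ b) = dia i a ⊔ dia i b :=
  le_antisymm (h.m3 i a b)
    (sup_le (h.dia_mono i le_sup_left) (h.dia_mono i le_sup_right))

theorem fixed_inf (h : IsMonadic dia box) {i : Ag} {a b : A} (ha : dia i a = a)
    (hb : dia i b = b) : dia i (a ⊓ b) = a ⊓ b :=
  le_antisymm (le_inf ((h.dia_mono i inf_le_left).trans ha.le)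
    ((h.dia_mono i inf_le_right).trans hb.le)) (h.m1 i _)

/-- A fixed `a` lies below `□(¬a → ⊥)`, since `a ≤ ¬¬a`. Then M7 gives `a ≤ ◇¬a → ◇⊥`, so `◇¬a` is
disjoint from `a`. -/
theorem fixed_compl (h : IsMonadic dia box) {i : Ag} {a : A} (ha : dia i a = a) :
    dia i aᶜ = aᶜ := by
  refine le_antisymm ?_ (h.m1 i _)
  rw [le_compl_iff_disjoint_right, disjoint_iff_inf_le, inf_comm, ← le_himp_iff]
  have h1 : a ≤ box i (aᶜ ⇨ ⊥) := by
    rw [h.le_box_iff ha, himp_bot]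
    exact le_compl_compl
  have h2 := h1.trans (h.m7 i _ _)
  rwa [h.dia_bot] at h2

theorem fixed_finset_sup (h : IsMonadic dia box) {i : Ag} {ι : Type*} (s : Finset ι)
    (f : ι → A) (hf : ∀ k ∈ s, dia i (f k) = f k) : dia i (s.sup f) = s.sup f := by
  classical
  induction s using Finset.induction_on with
  | empty => exact h.dia_bot i
  | insert k s hk ih =>
    rw [Finset.sup_insert, h.dia_sup, hf k (by simp), ih fun l hl => hf l (by simp [hl])]

/-- Minimal elements behave as atoms among the fixed points: `a ⊓ b` is itself a fixed point below
`a`. -/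
theorem isMin_inf (h : IsMonadic dia box) {i : Ag} {a b : A} (ha : IsMin (dia i) a)
    (hb : dia i b = b) : a ⊓ b = ⊥ ∨ a ≤ b := by
  by_cases hab : a ≤ b
  · exact Or.inr hab
  · refine Or.inl (ha.2.2 _ (inf_le_left.lt_of_ne fun he => hab (inf_eq_left.1 he))
      (h.fixed_inf ha.2.1 hb))

theorem isMin_le (h : IsMonadic dia box) {i : Ag} {a b : A} (ha : IsMin (dia i) a)
    (hb : dia i b = b) (hab : a ⊓ b ≠ ⊥) : a ≤ b :=
  (h.isMin_inf ha hb).resolve_left hab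

theorem isMin_eq (h : IsMonadic dia box) {i : Ag} {a b c : A} (ha : IsMin (dia i) a)
    (hb : IsMin (dia i) b) (hc : c ≠ ⊥) (hca : c ≤ a) (hcb : c ≤ b) : a = b := by
  have hab : a ⊓ b ≠ ⊥ := fun hn => hc (le_bot_iff.1 (hn ▸ le_inf hca hcb))
  exact le_antisymm (h.isMin_le ha hb.2.1 hab) (h.isMin_le hb ha.2.1 (by rwa [inf_comm]))

end IsMonadic

/-- The join of the `i`-minimal elements with the property `Q`, where `d` is `◇ᵢ`. -/
noncomputable def minSup [Finite A] (d : A → A) (Q : A → Prop) : A :=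
  (Set.toFinite {a | IsMin d a ∧ Q a}).toFinset.sup id

section MinSup

variable [Finite A] {d : A → A} {Q R : A → Prop}

theorem le_minSup {a : A} (ha : IsMin d a) (hQ : Q a) : a ≤ minSup d Q :=
  Finset.le_sup (f := id) (by simp [ha, hQ])

theorem minSup_le {c : A} (h : ∀ a, IsMin d a → Q a → a ≤ c) : minSup d Q ≤ c :=
  Finset.sup_le fun a ha => by
    simp only [Set.Finite.mem_toFinset, Set.mem_ofPred_eq] at ha
    exact h a ha.1 ha.2

theorem minSup_mono (h : ∀ a, IsMin d a → Q a → R a) : minSup d Q ≤ minSup d R :=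
  minSup_le fun a ha hQ => le_minSup ha (h a ha hQ)

end MinSup

namespace IsEpistemic

theorem exists_isMin_le (h : IsEpistemic dia box) {i : Ag} {b : A} (hb : dia i b = b)
    (hne : b ≠ ⊥) : ∃ a, IsMin (dia i) a ∧ a ≤ b := by
  have := h.finite
  obtain ⟨a, hab, ha⟩ := exists_minimal_le_of_wellFoundedLT
    (fun c => c ≠ ⊥ ∧ dia i c = c) b ⟨hne, hb⟩
  refine ⟨a, ⟨ha.prop.1, ha.prop.2, fun c hc hfix => ?_⟩, hab⟩
  by_contra hcb
  exact hc.not_ge (ha.le_of_le ⟨hcb, hfix⟩ hc.le)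

theorem minSup_fixed [Finite A] (h : IsEpistemic dia box) (i : Ag) (Q : A → Prop) :
    dia i (minSup (dia i) Q) = minSup (dia i) Q :=
  h.fixed_finset_sup _ _ fun a ha => by
    simp only [Set.Finite.mem_toFinset, Set.mem_ofPred_eq] at ha
    exact ha.1.2.1

/-- The complement of this join is fixed; if it were not `⊥`, it would contain a minimal element,
which also lies below the join. This only makes the join dense; law (E), applied to a fixed point,
upgrades that to `⊤`. -/
theorem minSup_true [Finite A] (h : IsEpistemic dia box) (i : Ag) :
    minSup (dia i) (fun _ => True) = ⊤ := by
  set t := minSup (dia i) fun _ => True with ht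
  have hfix : dia i t = t := h.minSup_fixed i _
  have hc : tᶜ = ⊥ := by
    by_contra hne
    obtain ⟨a, ha, hle⟩ := h.exists_isMin_le (h.fixed_compl hfix) hne
    have hat : a ≤ t := le_minSup ha trivial
    exact ha.1 (le_bot_iff.1 ((le_inf hat hle).trans (inf_compl_self t).le))
  have := h.e i t
  rwa [hfix, hc, sup_bot_eq] at this

/-- Inequalities may be tested below each `i`-minimal element. -/
theorem le_of_isMin (h : IsEpistemic dia box) (i : Ag) {x y : A}
    (hxy : ∀ a, IsMin (dia i) a → x ⊓ a ≤ y) : x ≤ y := by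
  have := h.finite
  have ht : minSup (dia i) (fun _ => True) ≤ x ⇨ y :=
    minSup_le fun a ha _ => by
      rw [le_himp_iff, inf_comm]
      exact hxy a ha
  rw [h.minSup_true, top_le_iff, himp_eq_top_iff] at ht
  exact ht

theorem exists_isMin_inf_ne_bot (h : IsEpistemic dia box) (i : Ag) {x : A} (hx : x ≠ ⊥) :
    ∃ a, IsMin (dia i) a ∧ x ⊓ a ≠ ⊥ := by
  by_contra! hn
  exact hx (le_bot_iff.1 (h.le_of_isMin i fun a ha => (hn a ha).le))

/-- Distinct minimal elements are disjoint. Together with `le_minSup`, this says that an inequality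
formula is either true or false throughout each minimal element. -/
theorem isMin_inf_minSup [Finite A] (h : IsEpistemic dia box) {i : Ag} {Q : A → Prop} {a : A}
    (ha : IsMin (dia i) a) (hQ : ¬ Q a) : a ⊓ minSup (dia i) Q = ⊥ := by
  refine le_bot_iff.1 ?_
  rw [inf_comm, ← le_himp_iff]
  refine minSup_le fun b hb hQb => ?_
  rw [le_himp_iff, le_bot_iff]
  by_contra hne
  have := h.isMin_eq ha hb hne inf_le_right inf_le_left
  exact hQ (this ▸ hQb)

theorem minSup_inf_le [Finite A] (h : IsEpistemic dia box) {i : Ag} {Q R S : A → Prop}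
    (hS : ∀ a, IsMin (dia i) a → Q a → R a → S a) :
    minSup (dia i) Q ⊓ minSup (dia i) R ≤ minSup (dia i) S := by
  refine h.le_of_isMin i fun a ha => ?_
  by_cases hQ : Q a
  · by_cases hR : R a
    · exact inf_le_right.trans (le_minSup ha (hS a ha hQ hR))
    · exact (le_inf inf_le_right (inf_le_left.trans inf_le_right)).trans
        ((h.isMin_inf_minSup ha hR).le.trans bot_le)
  · exact (le_inf inf_le_right (inf_le_left.trans inf_le_left)).trans
      ((h.isMin_inf_minSup ha hQ).le.trans bot_le)

theorem minSup_eq_top [Finite A] (h : IsEpistemic dia box) {i : Ag} {Q : A → Prop}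
    (hQ : ∀ a, IsMin (dia i) a → Q a) : minSup (dia i) Q = ⊤ :=
  top_le_iff.1 ((h.minSup_true i).ge.trans (minSup_mono fun a ha _ => hQ a ha))

theorem minSup_sup_eq_top [Finite A] (h : IsEpistemic dia box) {i : Ag} {Q R : A → Prop}
    (hQR : ∀ a, IsMin (dia i) a → Q a ∨ R a) :
    minSup (dia i) Q ⊔ minSup (dia i) R = ⊤ := by
  rw [← top_le_iff, ← h.minSup_true i]
  refine minSup_le fun a ha _ => ?_
  rcases hQR a ha with hQ | hR
  · exact (le_minSup ha hQ).trans le_sup_left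
  · exact (le_minSup ha hR).trans le_sup_right

end IsEpistemic

end Epistemic

-- Finite additivity of premeasures.

namespace IsPremeasure

variable {A : Type*} [HeytingAlgebra A] {d : A → A} {μ : A → ℝ}

theorem bot_of_isMin (h : IsPremeasure d μ) {a : A} (ha : IsMin d a) : μ ⊥ = 0 := h.bot ⟨a, ha⟩

/-- Measures are additive on finite families of pairwise disjoint elements. -/
theorem finset_sup (h : IsPremeasure d μ) {a : A} (ha : IsMin d a) {ι : Type*} (s : Finset ι)
    (f : ι → A) (hf : ∀ k ∈ s, f k ≤ a)
    (hd : ∀ k ∈ s, ∀ l ∈ s, k ≠ l → f k ⊓ f l = ⊥) : μ (s.sup f) = ∑ k ∈ s, μ (f k) := by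
  classical
  induction s using Finset.induction_on with
  | empty => simpa using h.bot_of_isMin ha
  | insert k s hk ih =>
    have hle : s.sup f ≤ a := Finset.sup_le fun l hl => hf l (by simp [hl])
    have hdis : f k ⊓ s.sup f = ⊥ := by
      rw [Finset.sup_inf_distrib_left, ← le_bot_iff]
      refine Finset.sup_le fun l hl => (hd k (by simp) l (by simp [hl]) ?_).le
      rintro rfl
      exact hk hl
    rw [Finset.sup_insert, Finset.sum_insert hk, h.join a ha _ _ (hf k (by simp)) hle, hdis,
      h.bot_of_isMin ha, ih (fun l hl => hf l (by simp [hl]))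
        (fun l hl o ho => hd l (by simp [hl]) o (by simp [ho])), sub_zero]

end IsPremeasure

end IPDEL

namespace IPDEL

-- Representatives in the pseudo-quotient, and its epistemic laws.

namespace PQ

variable {A : Type*} [HeytingAlgebra A] {a : A}

theorem iota_le_iota {q r : PQ a} : iota a q ≤ iota a r ↔ q ≤ r := Iff.rfl

theorem iota_inf_self (q : PQ a) : iota a q ⊓ a = iota a q := inf_eq_left.2 (iota_le a q)

theorem iota_inf (q r : PQ a) : iota a (q ⊓ r) = iota a q ⊓ iota a r := by
  change (iota a q ⊓ iota a r) ⊓ a = _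
  rw [inf_assoc, iota_inf_self]

theorem iota_sup (q r : PQ a) : iota a (q ⊔ r) = iota a q ⊔ iota a r := by
  change (iota a q ⊔ iota a r) ⊓ a = _
  exact inf_eq_left.2 (sup_le (iota_le a q) (iota_le a r))

theorem iota_himp (q r : PQ a) : iota a (q ⇨ r) = (iota a q ⇨ iota a r) ⊓ a := rfl

theorem iota_compl (q : PQ a) : iota a qᶜ = (iota a q)ᶜ ⊓ a := rfl

theorem iota_bot : iota a (⊥ : PQ a) = ⊥ := bot_inf_eq a

theorem iota_top : iota a (⊤ : PQ a) = a := top_inf_eq a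

theorem iota_eq_bot {q : PQ a} : iota a q = ⊥ ↔ q = ⊥ :=
  ⟨fun h => iota_inj (h.trans iota_bot.symm), fun h => h ▸ iota_bot⟩

theorem iota_lt_iota {q r : PQ a} : iota a q < iota a r ↔ q < r := by
  rw [lt_iff_le_not_ge, lt_iff_le_not_ge, iota_le_iota, iota_le_iota]

theorem iota_finset_sup {ι : Type*} (s : Finset ι) (f : ι → PQ a) :
    iota a (s.sup f) = s.sup fun k => iota a (f k) := by
  classical
  induction s using Finset.induction_on with
  | empty => exact iota_bot
  | insert k s hk ih => rw [Finset.sup_insert, Finset.sup_insert, iota_sup, ih]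

theorem iota_dia (d : A → A) (q : PQ a) : iota a (dia a d q) = d (iota a q) ⊓ a := by
  induction q using Quotient.ind with
  | _ b => rfl

theorem iota_box (bx : A → A) (q : PQ a) : iota a (box a bx q) = bx (a ⇨ iota a q) ⊓ a := by
  induction q using Quotient.ind with
  | _ b =>
    change bx (a ⇨ b) ⊓ a = bx (a ⇨ b ⊓ a) ⊓ a
    rw [himp_inf_distrib, himp_self, inf_top_eq]

/-- The pseudo-quotient of an epistemic Heyting algebra is one. -/
theorem isEpistemic {Ag : Type*} {d bx : Ag → A → A} (h : IsEpistemic d bx) (a : A) :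
    IsEpistemic (fun i => PQ.dia a (d i)) (fun i => PQ.box a (bx i)) where
  dia_mono i q r hqr := by
    rw [← iota_le_iota, iota_dia, iota_dia]
    exact inf_le_inf_right a (h.dia_mono i hqr)
  box_mono i q r hqr := by
    rw [← iota_le_iota, iota_box, iota_box]
    exact inf_le_inf_right a (h.box_mono i (himp_le_himp_left hqr))
  m1 i q := by
    rw [← iota_le_iota, iota_dia]
    exact le_inf (h.m1 i _) (iota_le a q)
  m2 i q := by
    rw [← iota_le_iota, iota_box]
    exact (inf_le_inf_right a (h.m2 i _)).trans himp_inf_le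
  m3 i q r := by
    rw [← iota_le_iota, iota_sup, iota_dia, iota_dia, iota_dia, iota_sup, ← inf_sup_right]
    exact inf_le_inf_right a (h.m3 i _ _)
  m4 i q r := by
    rw [← iota_le_iota, iota_himp, iota_box, iota_box, iota_box, iota_himp]
    refine le_inf (le_himp_iff.2 (le_inf ?_ (inf_le_right.trans inf_le_right))) inf_le_right
    -- Implication in the quotient is cut down to `a`, but the cut disappears under `a ⇨ _`, which
    -- leaves an instance of the original law.
    have h1 : a ⇨ ((iota a q ⇨ iota a r) ⊓ a) ≤ (a ⇨ iota a q) ⇨ (a ⇨ iota a r) := by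
      rw [himp_inf_distrib, himp_self, inf_top_eq, le_himp_iff, le_himp_iff]
      exact (le_inf ((inf_le_inf_right a inf_le_left).trans himp_inf_le)
        ((inf_le_inf_right a inf_le_right).trans himp_inf_le)).trans himp_inf_le
    refine (inf_le_inf inf_le_left inf_le_left).trans ?_
    rw [← le_himp_iff]
    exact (h.box_mono i h1).trans (h.m4 i _ _)
  m5 i q := by
    rw [← iota_le_iota, iota_box, iota_dia]
    refine le_inf (inf_le_left.trans ((h.m5 i _).trans (h.box_mono i ?_))) inf_le_right
    rw [himp_inf_distrib, himp_self, inf_top_eq]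
    exact le_himp
  m6 i q := by
    rw [← iota_le_iota, iota_dia, iota_box]
    exact inf_le_inf_right a ((h.dia_mono i inf_le_left).trans (h.m6 i _))
  m7 i q r := by
    rw [← iota_le_iota, iota_himp, iota_box, iota_himp, iota_dia, iota_dia]
    refine le_inf (le_himp_iff.2 (le_inf ?_ (inf_le_left.trans inf_le_right))) inf_le_right
    refine (inf_le_inf inf_le_left inf_le_left).trans ?_
    rw [← le_himp_iff]
    refine (h.box_mono i ?_).trans (h.m7 i _ _)
    rw [himp_inf_distrib, himp_self, inf_top_eq, himp_himp, inf_comm, iota_inf_self]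
  m8 i := by
    rw [← iota_le_iota, iota_dia, iota_bot, h.dia_bot, bot_inf_eq]
  m9 i := by
    rw [← iota_le_iota, iota_box, iota_top, himp_self, h.box_top, top_inf_eq]
  finite := have := h.finite; inferInstance
  e i q := by
    refine iota_inj ?_
    rw [iota_sup, iota_compl, iota_dia, iota_top]
    refine le_antisymm (sup_le inf_le_right inf_le_right) ?_
    have := h.e i (iota a q)
    calc a = (d i (iota a q) ⊔ (d i (iota a q))ᶜ) ⊓ a := by rw [this, top_inf_eq]
      _ = d i (iota a q) ⊓ a ⊔ (d i (iota a q))ᶜ ⊓ a := inf_sup_right _ _ _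
      _ ≤ _ := sup_le_sup_left (inf_le_inf_right a (compl_anti inf_le_left)) _

end PQ

-- The product algebra over an event frame.

namespace Model

variable {Ag : Type u} {At : Type v} (M : Model.{u, v, w} Ag At) (F : EventFrame Ag)

theorem dia_le_prodDia {i : Ag} {e e' : Fin F.n} (he : F.rel i e' e) (f : Fin F.n → M.carrier) :
    M.dia i (f e') ≤ prodDia M F i f e :=
  Finset.le_sup (f := fun e' => M.dia i (f e')) (by simp [he])

theorem prodDia_le {i : Ag} {e : Fin F.n} {f : Fin F.n → M.carrier} {c : M.carrier}
    (h : ∀ e', F.rel i e' e → M.dia i (f e') ≤ c) : prodDia M F i f e ≤ c :=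
  Finset.sup_le fun e' he => h e' (by simpa using he)

theorem prodBox_le_box {i : Ag} {e e' : Fin F.n} (he : F.rel i e' e) (f : Fin F.n → M.carrier) :
    prodBox M F i f e ≤ M.box i (f e') :=
  Finset.inf_le (f := fun e' => M.box i (f e')) (by simp [he])

theorem le_prodBox {i : Ag} {e : Fin F.n} {f : Fin F.n → M.carrier} {c : M.carrier}
    (h : ∀ e', F.rel i e' e → c ≤ M.box i (f e')) : c ≤ prodBox M F i f e :=
  Finset.le_inf fun e' he => h e' (by simpa using he)

variable {M}

/-- The product of an epistemic Heyting algebra over an event frame is epistemic. -/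
theorem isEpistemic_prod (h : IsEpistemic M.dia M.box) :
    IsEpistemic (prodDia M F) (prodBox M F) where
  dia_mono i f g hfg e := prodDia_le M F fun e' he =>
    (h.dia_mono i (hfg e')).trans (dia_le_prodDia M F he g)
  box_mono i f g hfg e := le_prodBox M F fun e' he =>
    (prodBox_le_box M F he f).trans (h.box_mono i (hfg e'))
  m1 i f e := (h.m1 i _).trans (dia_le_prodDia M F ((F.rel_equiv i).refl e) f)
  m2 i f e := (prodBox_le_box M F ((F.rel_equiv i).refl e) f).trans (h.m2 i _)
  m3 i f g e := prodDia_le M F fun e' he => (h.m3 i _ _).trans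
    (sup_le_sup (dia_le_prodDia M F he f) (dia_le_prodDia M F he g))
  m4 i f g e := le_himp_iff.2 <| le_prodBox M F fun e' he => by
    refine (inf_le_inf (prodBox_le_box M F he _) (prodBox_le_box M F he f)).trans ?_
    rw [← le_himp_iff]
    exact h.m4 i _ _
  m5 i f e := prodDia_le M F fun e' he => le_prodBox M F fun e'' he' =>
    (h.m5 i _).trans (h.box_mono i (dia_le_prodDia M F
      ((F.rel_equiv i).trans he ((F.rel_equiv i).symm he')) f))
  m6 i f e := prodDia_le M F fun e' he => le_prodBox M F fun e'' he' =>
    (h.dia_mono i (prodBox_le_box M F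
      ((F.rel_equiv i).trans he' ((F.rel_equiv i).symm he)) f)).trans (h.m6 i _)
  m7 i f g e := by
    refine le_himp_iff'.2 ?_
    rw [← le_himp_iff]
    refine prodDia_le M F fun e' he => ?_
    rw [le_himp_iff, inf_comm]
    refine (inf_le_inf_right _ (prodBox_le_box M F he _)).trans ?_
    rw [← le_himp_iff]
    exact (h.m7 i _ _).trans (himp_le_himp_left (dia_le_prodDia M F he g))
  m8 i e := prodDia_le M F fun e' _ => h.m8 i
  m9 i e := le_prodBox M F fun e' _ => h.m9 i
  finite := inferInstance
  e i f := by
    funext e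
    -- Each coordinate is a join of fixed points, so law (E) applied to that coordinate is already
    -- the required identity.
    have hfix : M.dia i (prodDia M F i f e) = prodDia M F i f e :=
      h.fixed_finset_sup _ _ fun e' _ => h.dia_dia i _
    have := h.e i (prodDia M F i f e)
    rwa [hfix] at this

end Model

end IPDEL

namespace IPDEL

-- The update of an APE-model: measures, minimal elements, normalization.

namespace Model

variable {Ag : Type u} {At : Type v} {M : Model.{u, v, w} Ag At} {F : EventFrame Ag}
  {Φ : Fin F.m → M.carrier}

/-- The semantic conditions on the interpretations of the formulas in `Φ`. -/
structure Coherent (M : Model.{u, v, w} Ag At) (F : EventFrame Ag) (Φ : Fin F.m → M.carrier) :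
    Prop where
  le : ∀ k l, F.prec k l → Φ k ≤ Φ l
  disjoint : ∀ k l, k ≠ l → ¬ F.prec k l → ¬ F.prec l k → Φ k ⊓ Φ l = ⊥

theorem mem_mb {k l : Fin F.m} :
    l ∈ F.mb k ↔ F.prec l k ∧ ∀ o, F.prec o k → ¬ F.prec l o := by
  simp [EventFrame.mb]

theorem le_preBar {e : Fin F.n} {k : Fin F.m} (h : F.pre e k ≠ 0) : Φ k ≤ preBar M F Φ e :=
  Finset.le_sup (f := Φ) (by simp [h])

theorem preBar_le {e : Fin F.n} {c : M.carrier} (h : ∀ k, F.pre e k ≠ 0 → Φ k ≤ c) :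
    preBar M F Φ e ≤ c :=
  Finset.sup_le fun k hk => h k (by simpa using hk)

section Measure

variable {i : Ag} {b : M.carrier}

/-- Distinct members of `mb(k)` are incomparable by maximality, hence disjoint by coherence, and
additivity collapses the sum. -/
theorem muPart_eq (hμ : IsPremeasure (M.dia i) (M.mu i)) (hΦ : Coherent M F Φ)
    (hb : IsMin (M.dia i) b) (k : Fin F.m) {x : M.carrier} (hx : x ≤ b) :
    muPart M F Φ i k x = M.mu i (x ⊓ Φ k) - M.mu i (x ⊓ (F.mb k).sup Φ) := by
  rw [muPart, Finset.sup_inf_distrib_left, hμ.finset_sup hb _ _ fun l _ => inf_le_left.trans hx]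
  intro l hl o ho hlo
  rw [mem_mb] at hl ho
  rw [← inf_inf_distrib_left, hΦ.disjoint l o hlo (hl.2 o ho.1) (ho.2 l hl.1), inf_bot_eq]

theorem mb_sup_le (hΦ : Coherent M F Φ) (k : Fin F.m) : (F.mb k).sup Φ ≤ Φ k :=
  Finset.sup_le fun l hl => hΦ.le l k (mem_mb.1 hl).1

theorem muPart_bot (hμ : IsPremeasure (M.dia i) (M.mu i)) (hb : IsMin (M.dia i) b)
    (k : Fin F.m) : muPart M F Φ i k ⊥ = 0 := by
  simp [muPart, hμ.bot_of_isMin hb]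

/-- Apply modularity to `x ⊓ Φ k` and `y ⊓ s`, with `s` the join over `mb(k)`: as `s ≤ Φ k`, their
meet is `x ⊓ s` and their join lies below `y ⊓ Φ k`. -/
theorem muPart_mono (hμ : IsPremeasure (M.dia i) (M.mu i)) (hΦ : Coherent M F Φ)
    (hb : IsMin (M.dia i) b) (k : Fin F.m) {x y : M.carrier} (hxy : x ≤ y) (hy : y ≤ b) :
    muPart M F Φ i k x ≤ muPart M F Φ i k y := by
  rw [muPart_eq hμ hΦ hb k hy, muPart_eq hμ hΦ hb k (hxy.trans hy)]
  set s := (F.mb k).sup Φ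
  have hs : s ≤ Φ k := mb_sup_le hΦ k
  have hj := hμ.join b hb (x ⊓ Φ k) (y ⊓ s) (inf_le_left.trans (hxy.trans hy))
    (inf_le_left.trans hy)
  have hm : x ⊓ Φ k ⊓ (y ⊓ s) = x ⊓ s := by
    rw [inf_inf_inf_comm, inf_eq_left.2 hxy, inf_eq_right.2 hs]
  rw [hm] at hj
  have := hμ.mono b hb (x ⊓ Φ k ⊔ y ⊓ s) (y ⊓ Φ k)
    (sup_le (inf_le_inf_right _ hxy) (inf_le_inf_left _ hs)) (inf_le_left.trans hy)
  linarith

theorem muPart_join (hμ : IsPremeasure (M.dia i) (M.mu i)) (hb : IsMin (M.dia i) b)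
    (k : Fin F.m) {x y : M.carrier} (hx : x ≤ b) (hy : y ≤ b) :
    muPart M F Φ i k (x ⊔ y) =
      muPart M F Φ i k x + muPart M F Φ i k y - muPart M F Φ i k (x ⊓ y) := by
  have key : ∀ z, M.mu i ((x ⊔ y) ⊓ z) =
      M.mu i (x ⊓ z) + M.mu i (y ⊓ z) - M.mu i (x ⊓ y ⊓ z) := fun z => by
    rw [inf_sup_right, hμ.join b hb _ _ (inf_le_left.trans hx) (inf_le_left.trans hy),
      ← inf_inf_distrib_right]
  simp only [muPart, key, Finset.sum_sub_distrib, Finset.sum_add_distrib]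
  ring

theorem muProd_bot (hμ : IsPremeasure (M.dia i) (M.mu i)) (hb : IsMin (M.dia i) b) :
    muProd M F Φ i ⊥ = 0 := by
  simp [muProd, muPart_bot hμ hb]

theorem muProd_mono (hμ : IsPremeasure (M.dia i) (M.mu i)) (hΦ : Coherent M F Φ)
    (hb : IsMin (M.dia i) b) {f g : Fin F.n → M.carrier} (hfg : f ≤ g) (hg : ∀ e, g e ≤ b) :
    muProd M F Φ i f ≤ muProd M F Φ i g :=
  Finset.sum_le_sum fun e _ => Finset.sum_le_sum fun k _ =>
    mul_le_mul_of_nonneg_right (mul_le_mul_of_nonneg_left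
      (muPart_mono hμ hΦ hb k (hfg e) (hg e)) (F.P_pos i e).le) (F.pre_nonneg e k)

theorem muProd_join (hμ : IsPremeasure (M.dia i) (M.mu i)) (hb : IsMin (M.dia i) b)
    {f g : Fin F.n → M.carrier} (hf : ∀ e, f e ≤ b) (hg : ∀ e, g e ≤ b) :
    muProd M F Φ i (f ⊔ g) =
      muProd M F Φ i f + muProd M F Φ i g - muProd M F Φ i (f ⊓ g) := by
  simp only [muProd, Pi.sup_apply, Pi.inf_apply, muPart_join hμ hb _ (hf _) (hg _)]
  simp only [← Finset.sum_sub_distrib, ← Finset.sum_add_distrib]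
  exact Finset.sum_congr rfl fun e _ => Finset.sum_congr rfl fun k _ => by ring

/-- Take `k` to be `≺`-minimal among the indices possible at `e` for which `y ⊓ Φ k` is not below
`x`. On every predecessor `x` and `y` then agree, so the subtracted sums are equal and strictness of
`μᵢ` on the part below `Φ k` decides. -/
theorem exists_muPart_lt (hμ : IsMeasure (M.dia i) (M.mu i)) (hb : IsMin (M.dia i) b)
    {e : Fin F.n} {x y : M.carrier} (hxy : x < y) (hy : y ≤ b) (hp : y ≤ preBar M F Φ e) :
    ∃ k, F.pre e k ≠ 0 ∧ muPart M F Φ i k x < muPart M F Φ i k y := by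
  have hex : ∃ k, F.pre e k ≠ 0 ∧ ¬ y ⊓ Φ k ≤ x := by
    by_contra! hn
    refine hxy.not_ge ?_
    have : preBar M F Φ e ≤ y ⇨ x := preBar_le fun k hk => by
      rw [le_himp_iff, inf_comm]
      exact hn k hk
    have := le_himp_iff.1 (hp.trans this)
    rwa [inf_idem] at this
  have : IsTrans (Fin F.m) F.prec := ⟨F.prec_trans⟩
  have : Std.Irrefl F.prec := ⟨F.prec_irrefl⟩
  obtain ⟨k, ⟨hk, hlt⟩, hmin⟩ := (Finite.wellFounded_of_trans_of_irrefl F.prec).has_min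
    {k | F.pre e k ≠ 0 ∧ ¬ y ⊓ Φ k ≤ x} hex
  refine ⟨k, hk, ?_⟩
  have hsum : ∑ l ∈ F.mb k, M.mu i (x ⊓ Φ l) = ∑ l ∈ F.mb k, M.mu i (y ⊓ Φ l) := by
    refine Finset.sum_congr rfl fun l hl => congrArg _ ?_
    have hlk := (mem_mb.1 hl).1
    have hle : y ⊓ Φ l ≤ x := by
      -- Compatibility read contrapositively: if `k` has nonzero weight at `e`, so has its
      -- predecessor `l`, and minimality of `k` applies to `l`.
      by_contra hn
      exact hmin l ⟨fun h0 => hk (F.compat e l k hlk h0), hn⟩ hlk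
    exact le_antisymm (inf_le_inf_right _ hxy.le) (le_inf hle inf_le_right)
  rw [muPart, muPart, hsum]
  refine sub_lt_sub_right (hμ.strict b hb _ _ ?_ (inf_le_left.trans hy)) _
  exact (inf_le_inf_right _ hxy.le).lt_of_ne fun he => hlt (he ▸ inf_le_left)

theorem muProd_strict (hμ : IsMeasure (M.dia i) (M.mu i)) (hΦ : Coherent M F Φ)
    (hb : IsMin (M.dia i) b) {f g : Fin F.n → M.carrier} (hfg : f < g) (hg : ∀ e, g e ≤ b)
    (hp : g ≤ preBar M F Φ) : muProd M F Φ i f < muProd M F Φ i g := by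
  obtain ⟨hle, e, he⟩ := Pi.lt_def.1 hfg
  obtain ⟨k, hk, hlt⟩ := exists_muPart_lt hμ hb he (hg e) (hp e)
  have hterm : ∀ e k, F.P i e * muPart M F Φ i k (f e) * F.pre e k ≤
      F.P i e * muPart M F Φ i k (g e) * F.pre e k := fun e k =>
    mul_le_mul_of_nonneg_right (mul_le_mul_of_nonneg_left
      (muPart_mono hμ.toIsPremeasure hΦ hb k (hle e) (hg e)) (F.P_pos i e).le) (F.pre_nonneg e k)
  refine Finset.sum_lt_sum (fun e _ => Finset.sum_le_sum fun k _ => hterm e k)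
    ⟨e, Finset.mem_univ e, Finset.sum_lt_sum (fun k _ => hterm e k) ⟨k, Finset.mem_univ k, ?_⟩⟩
  exact mul_lt_mul_of_pos_right (mul_lt_mul_of_pos_left hlt (F.P_pos i e))
    ((F.pre_nonneg e k).lt_of_ne' hk)

end Measure

section Minimal

theorem isEpistemic_upd (h : IsEpistemic M.dia M.box) :
    IsEpistemic (updDia M F Φ) (updBox M F Φ) :=
  PQ.isEpistemic (isEpistemic_prod F h) _

variable (M F Φ) in
/-- The element of the product algebra with the value `b ⊓ pre` on the cell of `e`. -/
noncomputable def cellElem (i : Ag) (e : Fin F.n) (b : M.carrier) : Fin F.n → M.carrier :=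
  open scoped Classical in
  fun e' => if F.rel i e' e then b ⊓ preBar M F Φ e' else ⊥

variable (M F Φ) in
/-- The class of `cellElem`. -/
noncomputable def cellClass (i : Ag) (e : Fin F.n) (b : M.carrier) : PQ (preBar M F Φ) :=
  PQ.mk _ (cellElem M F Φ i e b)

variable {i : Ag} {e : Fin F.n} {b : M.carrier}

theorem cellElem_of_rel {e' : Fin F.n} (h : F.rel i e' e) :
    cellElem M F Φ i e b e' = b ⊓ preBar M F Φ e' := if_pos h

theorem cellElem_of_not_rel {e' : Fin F.n} (h : ¬ F.rel i e' e) :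
    cellElem M F Φ i e b e' = ⊥ := if_neg h

theorem cellElem_le_preBar : cellElem M F Φ i e b ≤ preBar M F Φ := fun e' => by
  by_cases h : F.rel i e' e
  · exact (cellElem_of_rel h).trans_le inf_le_right
  · exact (cellElem_of_not_rel h).trans_le bot_le

theorem cellElem_le (e' : Fin F.n) : cellElem M F Φ i e b e' ≤ b := by
  by_cases h : F.rel i e' e
  · exact (cellElem_of_rel h).trans_le inf_le_left
  · exact (cellElem_of_not_rel h).trans_le bot_le

theorem iota_cellClass :
    PQ.iota _ (cellClass M F Φ i e b) = cellElem M F Φ i e b :=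
  inf_eq_left.2 cellElem_le_preBar

theorem cellClass_fixed (h : IsEpistemic M.dia M.box) (hb : M.dia i b = b) :
    updDia M F Φ i (cellClass M F Φ i e b) = cellClass M F Φ i e b := by
  refine le_antisymm ?_ ((isEpistemic_upd h).m1 i _)
  rw [← PQ.iota_le_iota, updDia, PQ.iota_dia, iota_cellClass]
  intro e'
  by_cases he : F.rel i e' e
  · rw [cellElem_of_rel he]
    exact inf_le_inf_right _ (prodDia_le M F fun e'' _ =>
      (h.dia_mono i (cellElem_le e'')).trans hb.le)
  · refine inf_le_left.trans (prodDia_le M F fun e'' he' => ?_)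
    rw [cellElem_of_not_rel fun hr => he ((F.rel_equiv i).trans ((F.rel_equiv i).symm he') hr)]
    exact (h.m8 i).trans bot_le

/-- A nonzero fixed `q` below the class has a nonzero value at some event of the cell. Its `◇ᵢ` is a
fixed point meeting `b`, hence above `b`, and the product modality spreads it over the whole cell,
so `q` is the whole class. -/
theorem isMin_cellClass (h : IsEpistemic M.dia M.box) (hb : IsMin (M.dia i) b)
    (hne : cellClass M F Φ i e b ≠ ⊥) : IsMin (updDia M F Φ i) (cellClass M F Φ i e b) := by
  refine ⟨hne, cellClass_fixed h hb.2.1, fun q hq hfix => ?_⟩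
  by_contra hqb
  refine hq.not_ge ?_
  have hle : PQ.iota _ q ≤ cellElem M F Φ i e b := by
    rw [← iota_cellClass, PQ.iota_le_iota]
    exact hq.le
  obtain ⟨e', he'⟩ : ∃ e', PQ.iota _ q e' ≠ ⊥ := by
    by_contra! hn
    exact hqb (PQ.iota_eq_bot.1 (funext hn))
  have hr : F.rel i e' e := by
    by_contra hn
    exact he' (le_bot_iff.1 ((hle e').trans_eq (cellElem_of_not_rel hn)))
  have hdb : b ≤ M.dia i (PQ.iota _ q e') := by
    refine h.isMin_le hb (h.dia_dia i _) fun hn => he' (le_bot_iff.1 ?_)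
    exact hn ▸ le_inf ((hle e').trans (cellElem_le e')) (h.m1 i _)
  rw [← PQ.iota_le_iota, iota_cellClass, ← hfix, updDia, PQ.iota_dia]
  intro e''
  by_cases hr' : F.rel i e'' e
  · rw [cellElem_of_rel hr']
    exact inf_le_inf_right _ (hdb.trans
      (dia_le_prodDia M F ((F.rel_equiv i).trans hr ((F.rel_equiv i).symm hr')) _))
  · exact (cellElem_of_not_rel hr').trans_le bot_le

/-- Every `i`-minimal element of the updated algebra is the class of a `cellElem`. -/
theorem exists_eq_cellClass (h : IsEpistemic M.dia M.box) {q : PQ (preBar M F Φ)}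
    (hq : IsMin (updDia M F Φ i) q) (he : PQ.iota _ q e ≠ ⊥) :
    ∃ b, IsMin (M.dia i) b ∧ q = cellClass M F Φ i e b := by
  -- Any `b` meeting the value of `q` at `e` works: its class then meets `q`, and two minimal
  -- elements that meet are equal.
  obtain ⟨b, hb, hne⟩ := h.exists_isMin_inf_ne_bot i he
  have hinf : q ⊓ cellClass M F Φ i e b ≠ ⊥ := by
    intro hn
    have := congrFun (PQ.iota_eq_bot.2 hn) e
    rw [PQ.iota_inf, iota_cellClass, Pi.inf_apply, cellElem_of_rel ((F.rel_equiv i).refl e),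
      inf_comm b, ← inf_assoc, ← Pi.inf_apply, PQ.iota_inf_self] at this
    exact hne this
  have hmin := isMin_cellClass h hb (e := e) (F := F) (Φ := Φ) fun hn =>
    hinf (by rw [hn, inf_bot_eq])
  exact ⟨b, hb, (isEpistemic_upd h).isMin_eq hq hmin hinf inf_le_left inf_le_right⟩

/-- One old minimal element bounds all coordinates, so the laws of `μᵢ`, which hold only below
minimal elements, apply to `muProd` at every event at once. -/
theorem exists_bound (h : IsEpistemic M.dia M.box) {q : PQ (preBar M F Φ)}
    (hq : IsMin (updDia M F Φ i) q) : ∃ b, IsMin (M.dia i) b ∧ ∀ e, PQ.iota _ q e ≤ b := by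
  obtain ⟨e, he⟩ : ∃ e, PQ.iota _ q e ≠ ⊥ := by
    by_contra! hn
    exact hq.1 (PQ.iota_eq_bot.1 (funext hn))
  obtain ⟨b, hb, rfl⟩ := exists_eq_cellClass h hq he
  refine ⟨b, hb, fun e' => ?_⟩
  rw [iota_cellClass]
  exact cellElem_le e'

end Minimal

section UpdateMeasure

variable {i : Ag}

/-- The minimal element above a nonzero `q` is unique, so the choice in `updMu` is harmless; at `⊥`
the quotient is `0` as well. -/
theorem updMu_eq (hM : M.IsAPE) {q f : PQ (preBar M F Φ)}
    (hf : IsMin (updDia M F Φ i) f) (hqf : q ≤ f) :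
    updMu M F Φ i q = muProd M F Φ i (PQ.iota _ q) / muProd M F Φ i (PQ.iota _ f) := by
  by_cases hq : q = ⊥
  · obtain ⟨b, hb, -⟩ := exists_bound hM.epistemic hf
    rw [updMu, if_pos hq, hq, PQ.iota_bot, muProd_bot (hM.measure i).toIsPremeasure hb, zero_div]
  · have hex : ∃ f, IsMin (updDia M F Φ i) f ∧ q ≤ f := ⟨f, hf, hqf⟩
    rw [updMu, if_neg hq, dif_pos hex, (isEpistemic_upd hM.epistemic).isMin_eq
      hex.choose_spec.1 hf hq hex.choose_spec.2 hqf]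

theorem muProd_pos (hM : M.IsAPE) (hΦ : Coherent M F Φ) {f : PQ (preBar M F Φ)}
    (hf : IsMin (updDia M F Φ i) f) : 0 < muProd M F Φ i (PQ.iota _ f) := by
  obtain ⟨b, hb, hle⟩ := exists_bound hM.epistemic hf
  rw [← muProd_bot (F := F) (Φ := Φ) (hM.measure i).toIsPremeasure hb]
  exact muProd_strict (hM.measure i) hΦ hb
    (bot_lt_iff_ne_bot.2 fun hn => hf.1 (PQ.iota_eq_bot.1 hn)) hle (PQ.iota_le _ f)

/-- Below a fixed minimal `f` the measure is `muProd` divided by one positive constant, so each law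
descends from `muProd`. -/
theorem isMeasure_upd (hM : M.IsAPE) (hΦ : Coherent M F Φ) (i : Ag) :
    IsMeasure (updDia M F Φ i) (updMu M F Φ i) where
  nonneg f hf q hqf := by
    obtain ⟨b, hb, hle⟩ := exists_bound hM.epistemic hf
    rw [updMu_eq hM hf hqf]
    refine div_nonneg ?_ (muProd_pos hM hΦ hf).le
    rw [← muProd_bot (F := F) (Φ := Φ) (hM.measure i).toIsPremeasure hb]
    exact muProd_mono (hM.measure i).toIsPremeasure hΦ hb bot_le
      fun e => (PQ.iota_le_iota.2 hqf e).trans (hle e)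
  mono f hf q r hqr hrf := by
    obtain ⟨b, hb, hle⟩ := exists_bound hM.epistemic hf
    rw [updMu_eq hM hf (hqr.trans hrf), updMu_eq hM hf hrf]
    refine div_le_div_of_nonneg_right ?_ (muProd_pos hM hΦ hf).le
    exact muProd_mono (hM.measure i).toIsPremeasure hΦ hb (PQ.iota_le_iota.2 hqr)
      fun e => (PQ.iota_le_iota.2 hrf e).trans (hle e)
  join f hf q r hqf hrf := by
    obtain ⟨b, hb, hle⟩ := exists_bound hM.epistemic hf
    rw [updMu_eq hM hf (sup_le hqf hrf), updMu_eq hM hf hqf, updMu_eq hM hf hrf,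
      updMu_eq hM hf (inf_le_left.trans hqf), PQ.iota_sup, PQ.iota_inf,
      muProd_join (hM.measure i).toIsPremeasure hb
        (fun e => (PQ.iota_le_iota.2 hqf e).trans (hle e))
        (fun e => (PQ.iota_le_iota.2 hrf e).trans (hle e)), sub_div, add_div]
  bot _ := if_pos rfl
  strict f hf q r hqr hrf := by
    obtain ⟨b, hb, hle⟩ := exists_bound hM.epistemic hf
    rw [updMu_eq hM hf (hqr.le.trans hrf), updMu_eq hM hf hrf]
    refine div_lt_div_of_pos_right ?_ (muProd_pos hM hΦ hf)
    exact muProd_strict (hM.measure i) hΦ hb (PQ.iota_lt_iota.2 hqr)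
      (fun e => (PQ.iota_le_iota.2 hrf e).trans (hle e)) (PQ.iota_le _ r)
  one f hf := by
    rw [updMu_eq hM hf le_rfl, div_self (muProd_pos hM hΦ hf).ne']

/-- The update of an APE-model is an APE-model. -/
theorem IsAPE.update (hM : M.IsAPE) (hΦ : Coherent M F Φ) (s : Fin F.n → At → M.carrier) :
    (M.update F Φ s).IsAPE where
  epistemic := isEpistemic_upd hM.epistemic
  measure := isMeasure_upd hM hΦ

end UpdateMeasure

end Model

end IPDEL

namespace IPDEL

-- Values of linear terms, and interpretation in an updated model.

open Model

variable {Ag : Type u} {At : Type v} {M : Model.{u, v, w} Ag At}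

namespace LTerm

/-- The value of a linear term of agent `i` at an element of a model. -/
noncomputable def value (M : Model.{u, v, w} Ag At) (i : Ag) (t : LTerm Ag At)
    (a : M.carrier) : ℝ :=
  ∑ k, t.coeff k * M.mu i (interp (t.arg k) M ⊓ a)

theorem interp_ge (i : Ag) (t : LTerm Ag At) (β : ℝ) :
    interp (ge i t β) M = minSup (M.dia i) fun a => β ≤ t.value M i a := rfl

variable (i : Ag) (a : M.carrier)

theorem value_zero : (zero : LTerm Ag At).value M i a = 0 := Finset.sum_empty

theorem value_single (α : ℝ) (φ : Formula Ag At) :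
    (single α φ).value M i a = α * M.mu i (interp φ M ⊓ a) :=
  Fin.sum_univ_one _

theorem value_mu (φ : Formula Ag At) : (mu φ).value M i a = M.mu i (interp φ M ⊓ a) := by
  rw [mu, value_single, one_mul]

theorem value_add (t t' : LTerm Ag At) :
    (t.add t').value M i a = t.value M i a + t'.value M i a := by
  refine (Fin.sum_univ_add (fun k => Fin.append t.coeff t'.coeff k *
    M.mu i (interp (Fin.append t.arg t'.arg k) M ⊓ a))).trans ?_
  simp [value]

theorem value_smul (d : ℝ) (t : LTerm Ag At) :
    (t.smul d).value M i a = d * t.value M i a := by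
  simp only [value, smul, Finset.mul_sum, mul_assoc]
  rfl

theorem value_neg (t : LTerm Ag At) : t.neg.value M i a = - t.value M i a := by
  rw [neg, value_smul, neg_one_mul]

theorem value_bigSum (l : List (LTerm Ag At)) :
    (bigSum l).value M i a = (l.map fun t => t.value M i a).sum := by
  induction l with
  | nil => exact value_zero i a
  | cons t l ih => rw [bigSum, value_add, ih, List.map_cons, List.sum_cons]

end LTerm

namespace Model

theorem interp_iff_eq_top {φ ψ : Formula Ag At} :
    interp (.iff φ ψ) M = ⊤ ↔ interp φ M = interp ψ M := by
  change (interp φ M ⇨ interp ψ M) ⊓ (interp ψ M ⇨ interp φ M) = ⊤ ↔ _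
  rw [inf_eq_top_iff, himp_eq_top_iff, himp_eq_top_iff, le_antisymm_iff]

theorem interp_top : interp (.top : Formula Ag At) M = ⊤ := himp_self

theorem interp_bigOr_le {l : List (Formula Ag At)} {c : M.carrier} :
    interp (.bigOr l) M ≤ c ↔ ∀ φ ∈ l, interp φ M ≤ c := by
  induction l with
  | nil => exact iff_of_true bot_le (by simp)
  | cons φ l ih =>
    change interp φ M ⊔ interp (.bigOr l) M ≤ c ↔ _
    rw [sup_le_iff, ih, List.forall_mem_cons]

theorem le_interp_bigAnd {l : List (Formula Ag At)} {c : M.carrier} :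
    c ≤ interp (.bigAnd l) M ↔ ∀ φ ∈ l, c ≤ interp φ M := by
  induction l with
  | nil => exact iff_of_true (le_top.trans_eq interp_top.symm) (by simp)
  | cons φ l ih =>
    change c ≤ interp φ M ⊓ interp (.bigAnd l) M ↔ _
    rw [le_inf_iff, ih, List.forall_mem_cons]

/-- The interpretations of the formulas in `Φ`. -/
noncomputable abbrev interpΦ (M : Model.{u, v, w} Ag At) (E : EventStr Ag At) :
    Fin E.frame.m → M.carrier :=
  fun k => interp (E.Φ k) M

/-- The element of `M` that interprets the precondition of `e`. -/
noncomputable abbrev preE (M : Model.{u, v, w} Ag At) (E : EventStr Ag At) :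
    Fin E.frame.n → M.carrier :=
  preBar M E.frame (interpΦ M E)

/-- The update of a model with an event structure. -/
noncomputable abbrev updE (M : Model.{u, v, w} Ag At) (E : EventStr Ag At) :
    Model.{u, v, w} Ag At :=
  M.update E.frame (interpΦ M E) fun e p => interp (E.sub e p) M

/-- The interpretation of `φ` in the updated model. -/
noncomputable def evClass (M : Model.{u, v, w} Ag At) (E : EventStr Ag At)
    (φ : Formula Ag At) : PQ (preE M E) :=
  interp φ (updE M E)

/-- The representative below `pre` of the interpretation of `φ` in the updated model. -/
noncomputable def ev (M : Model.{u, v, w} Ag At) (E : EventStr Ag At) (φ : Formula Ag At) :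
    Fin E.frame.n → M.carrier :=
  PQ.iota (preE M E) (evClass M E φ)

variable {E : EventStr Ag At} {e : Fin E.frame.n} {φ ψ : Formula Ag At} {i : Ag}

theorem interp_dBox : interp (.dBox E e φ) M = preE M E e ⇨ ev M E φ e := rfl

/-- The representative already lies below the precondition, so the meet with it is redundant. -/
theorem interp_dDia : interp (.dDia E e φ) M = ev M E φ e :=
  inf_eq_right.2 (PQ.iota_le (preE M E) _ e)

theorem ev_le (φ : Formula Ag At) (e : Fin E.frame.n) : ev M E φ e ≤ preE M E e :=
  PQ.iota_le (preE M E) _ e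

theorem ev_atom (p : At) : ev M E (.atom p) e = interp (E.sub e p) M ⊓ preE M E e := rfl

theorem ev_bot : ev M E .bot e = ⊥ := congrFun (PQ.iota_bot (a := preE M E)) e

theorem ev_top : ev M E .top e = preE M E e := by
  rw [ev, evClass, interp_top]
  exact congrFun (PQ.iota_top (a := preE M E)) e

theorem ev_and : ev M E (.and φ ψ) e = ev M E φ e ⊓ ev M E ψ e :=
  congrFun (PQ.iota_inf (a := preE M E) _ _) e

theorem ev_or : ev M E (.or φ ψ) e = ev M E φ e ⊔ ev M E ψ e :=
  congrFun (PQ.iota_sup (a := preE M E) _ _) e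

theorem ev_imp : ev M E (.imp φ ψ) e = (ev M E φ e ⇨ ev M E ψ e) ⊓ preE M E e := rfl

theorem ev_dia : ev M E (.dia i φ) e = prodDia M E.frame i (ev M E φ) e ⊓ preE M E e :=
  congrFun (PQ.iota_dia (a := preE M E) _ _) e

theorem ev_box : ev M E (.box i φ) e =
    prodBox M E.frame i (fun e => preE M E e ⇨ ev M E φ e) e ⊓ preE M E e :=
  congrFun (PQ.iota_box (a := preE M E) _ _) e

theorem interp_preF : interp (E.preF e) M = preE M E e :=
  eq_of_forall_ge_iff fun c => by
    simp [EventStr.preF, interp_bigOr_le, preE, preBar]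

theorem mem_cell {e' : Fin E.frame.n} : e' ∈ E.cell i e ↔ E.frame.rel i e' e := by
  simp [EventStr.cell]

theorem interp_bigOr_cell :
    interp (.bigOr ((E.cell i e).map fun e' => .dia i (.dDia E e' φ))) M =
      prodDia M E.frame i (ev M E φ) e :=
  eq_of_forall_ge_iff fun c => by
    have : ∀ e', interp (.dia i (.dDia E e' φ)) M = M.dia i (ev M E φ e') :=
      fun e' => congrArg (M.dia i) interp_dDia
    simp [interp_bigOr_le, prodDia, mem_cell, this]

theorem interp_bigAnd_cell :
    interp (.bigAnd ((E.cell i e).map fun e' => .box i (.dBox E e' φ))) M =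
      prodBox M E.frame i (fun e => preE M E e ⇨ ev M E φ e) e :=
  eq_of_forall_le_iff fun c => by
    have : ∀ e', interp (.box i (.dBox E e' φ)) M = M.box i (preE M E e' ⇨ ev M E φ e') :=
      fun e' => rfl
    simp [le_interp_bigAnd, prodBox, mem_cell, this]

/-! ### Inequalities after an update -/

theorem value_muT (k : Fin E.frame.m) (χ : Formula Ag At) (a : M.carrier) :
    (E.muT k χ).value M i a = muPart M E.frame (interpΦ M E) i k (interp χ M ⊓ a) := by
  classical
  have key : ∀ l, (LTerm.mu (.and χ (E.Φ l))).value M i a =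
      M.mu i (interp χ M ⊓ a ⊓ interpΦ M E l) := fun l => by
    rw [LTerm.value_mu, inf_right_comm]
    rfl
  rw [EventStr.muT, LTerm.value_add, LTerm.value_neg, LTerm.value_bigSum, key, List.map_map,
    ← sub_eq_add_neg, muPart, ← List.sum_toFinset _ ((List.nodup_finRange _).filter _)]
  congr 1
  refine Finset.sum_congr ?_ fun l _ => key l
  ext l
  simp

theorem value_sumT (c : ℝ) (χ : Fin E.frame.n → Formula Ag At) (a : M.carrier) :
    (E.sumT i e c χ).value M i a = open scoped Classical in
      ∑ e' with E.frame.rel i e' e, ∑ k, c * E.frame.P i e' * E.frame.pre e' k *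
        muPart M E.frame (interpΦ M E) i k (interp (χ e') M ⊓ a) := by
  classical
  have hn : (E.cell i e).Nodup := (List.nodup_finRange _).filter _
  rw [EventStr.sumT, LTerm.value_bigSum, List.map_map, ← List.sum_toFinset _ hn]
  refine Finset.sum_congr (by ext e'; simp [mem_cell]) fun e' _ => ?_
  rw [Function.comp_apply, LTerm.value_bigSum, List.map_map,
    ← List.sum_toFinset _ (List.nodup_finRange _)]
  refine Finset.sum_congr (by ext k; simp) fun k _ => ?_
  rw [Function.comp_apply, LTerm.value_smul, value_muT]

/-- Only parts below `Φ k` enter, since the members of `mb(k)` lie below it. This lets `[𝓔, e']ψ` be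
traded for its representative below the precondition. -/
theorem muPart_congr {F : EventFrame Ag} {Φ : Fin F.m → M.carrier} (hΦ : Coherent M F Φ)
    {k : Fin F.m} {p x y : M.carrier} (hk : Φ k ≤ p) (hxy : x ⊓ p = y ⊓ p) :
    muPart M F Φ i k x = muPart M F Φ i k y := by
  have key : ∀ z ≤ p, x ⊓ z = y ⊓ z := fun z hz => by
    rw [← inf_eq_right.2 hz, ← inf_assoc, hxy, inf_assoc]
  rw [muPart, muPart, key _ hk]
  congr 1
  exact Finset.sum_congr rfl fun l hl =>
    congrArg _ (key _ ((hΦ.le l k (mem_mb.1 hl).1).trans hk))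

/-- A sum over the cell of `e` of partial measures is a value of `muProd`. -/
theorem value_sumT_eq_muProd (hM : M.IsAPE) (hΦ : Coherent M E.frame (interpΦ M E)) (c : ℝ)
    (χ : Fin E.frame.n → Formula Ag At) {b : M.carrier} (hb : IsMin (M.dia i) b)
    {f : Fin E.frame.n → M.carrier}
    (hf : ∀ e', interp (χ e') M ⊓ preE M E e' = f e' ⊓ preE M E e') :
    (E.sumT i e c χ).value M i b = c * muProd M E.frame (interpΦ M E) i
      (f ⊓ cellElem M E.frame (interpΦ M E) i e b) := by
  classical
  rw [value_sumT, muProd, Finset.mul_sum, Finset.sum_filter]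
  refine Finset.sum_congr rfl fun e' _ => ?_
  split_ifs with he
  · rw [Finset.mul_sum]
    refine Finset.sum_congr rfl fun k _ => ?_
    -- Terms of weight zero vanish; otherwise `Φ k` lies below the precondition of `e'`.
    by_cases hk : E.frame.pre e' k = 0
    · simp [hk]
    · rw [muPart_congr hΦ (y := (f ⊓ cellElem M E.frame (interpΦ M E) i e b) e')
        (le_preBar hk)]
      · ring
      · rw [Pi.inf_apply, cellElem_of_rel he, inf_right_comm, hf e']
        simp only [inf_left_comm, inf_idem, inf_comm]
  -- Outside the cell `cellElem` is `⊥`, so the sum over all events in `muProd` reduces to the cell.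
  · rw [Pi.inf_def]
    simp only [cellElem_of_not_rel he, inf_bot_eq,
      muPart_bot (hM.measure i).toIsPremeasure hb]
    simp

theorem value_redF (hM : M.IsAPE) (hΦ : Coherent M E.frame (interpΦ M E)) {α β : ℝ}
    {b : M.carrier} (hb : IsMin (M.dia i) b) :
    (LTerm.add (E.sumT i e α fun e' => .dBox E e' ψ)
      (E.sumT i e (-β) fun _ => .top)).value M i b =
    α * muProd M E.frame (interpΦ M E) i
        (ev M E ψ ⊓ cellElem M E.frame (interpΦ M E) i e b) -
      β * muProd M E.frame (interpΦ M E) i (cellElem M E.frame (interpΦ M E) i e b) := by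
  rw [LTerm.value_add, value_sumT_eq_muProd hM hΦ α _ hb (f := ev M E ψ),
    value_sumT_eq_muProd hM hΦ (-β) _ hb (f := ⊤), top_inf_eq]
  · ring
  · intro e'
    rw [interp_top, Pi.top_apply]
  · intro e'
    rw [interp_dBox]
    exact le_antisymm (le_inf himp_inf_le inf_le_right) (inf_le_inf_right _ le_himp)

/-- The updated measure is a quotient whose denominator is the positive `muProd` of the cell.
Clearing it gives `α · numerator - β · denominator ≥ 0`, and by `value_redF` these two summands are
the values of `C` and `D` at `b`. -/
theorem le_updMu_iff (hM : M.IsAPE) (hΦ : Coherent M E.frame (interpΦ M E)) {α β : ℝ}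
    {b : M.carrier} (hb : IsMin (M.dia i) b)
    (hne : cellClass M E.frame (interpΦ M E) i e b ≠ ⊥) :
    β ≤ α * updMu M E.frame (interpΦ M E) i
        (evClass M E ψ ⊓ cellClass M E.frame (interpΦ M E) i e b) ↔
      0 ≤ (LTerm.add (E.sumT i e α fun e' => .dBox E e' ψ)
        (E.sumT i e (-β) fun _ => .top)).value M i b := by
  have hmin := isMin_cellClass hM.epistemic hb hne
  have hpos := muProd_pos hM hΦ hmin
  rw [updMu_eq hM hmin inf_le_right, value_redF hM hΦ hb, PQ.iota_inf, iota_cellClass,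
    ← mul_div_assoc, sub_nonneg, ← ev]
  rw [iota_cellClass] at hpos
  exact le_div_iff₀ hpos

/-- The updated minimal elements that are nonzero at `e` are classes `cellClass e b`, with value `b
⊓ pre(e)` at `e`. So both sides are joins over old minimal `b`, and `le_updMu_iff` matches the
conditions. -/
theorem ev_ge (hM : M.IsAPE) (hΦ : Coherent M E.frame (interpΦ M E)) (α β : ℝ) :
    ev M E (LTerm.ge i (.single α ψ) β) e = preE M E e ⊓ interp (E.redF i e α β ψ) M := by
  have hev : ev M E (LTerm.ge i (.single α ψ) β) e =
      PQ.iota (preE M E) (minSup (updDia M E.frame (interpΦ M E) i) fun q =>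
        β ≤ α * updMu M E.frame (interpΦ M E) i (evClass M E ψ ⊓ q)) e := by
    have : interp (LTerm.ge i (.single α ψ) β) (updE M E) =
        minSup ((updE M E).dia i) fun q => β ≤ α * (updE M E).mu i (interp ψ (updE M E) ⊓ q) := by
      rw [LTerm.interp_ge]
      simp only [LTerm.value_single]
    rw [ev, evClass, this]
    rfl
  rw [hev, EventStr.redF, LTerm.interp_ge]
  refine le_antisymm (le_inf (PQ.iota_le (preE M E) _ e) ?_) ?_
  · rw [minSup, PQ.iota_finset_sup, Finset.sup_apply]
    refine Finset.sup_le fun q hq => ?_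
    simp only [Set.Finite.mem_toFinset, Set.mem_ofPred_eq] at hq
    by_cases he : PQ.iota _ q e = ⊥
    · exact he.trans_le bot_le
    · obtain ⟨b, hb, rfl⟩ := exists_eq_cellClass hM.epistemic hq.1 he
      refine le_trans ?_ (le_minSup hb ((le_updMu_iff hM hΦ hb hq.1.1).1 hq.2))
      rw [id, iota_cellClass]
      exact cellElem_le e
  · rw [inf_comm, ← le_himp_iff]
    refine minSup_le fun b hb hQ => ?_
    rw [le_himp_iff]
    have hcell : b ⊓ preE M E e = PQ.iota _ (cellClass M E.frame (interpΦ M E) i e b) e := by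
      rw [iota_cellClass, cellElem_of_rel ((E.frame.rel_equiv i).refl e)]
    rw [hcell]
    -- A `b` with zero class may satisfy the reduced inequality without giving an updated minimal
    -- element, but then `b ⊓ pre(e) = ⊥`.
    by_cases hne : cellClass M E.frame (interpΦ M E) i e b = ⊥
    · rw [hne, PQ.iota_bot]
      exact bot_le
    · exact PQ.iota_le_iota.2 (le_minSup (isMin_cellClass hM.epistemic hb hne)
        ((le_updMu_iff hM hΦ hb hne).2 hQ)) e

end Model

end IPDEL

namespace IPDEL

open Model

-- Semantic side conditions, validity of the axioms, and soundness.

variable {Ag : Type u} {At : Type v}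

/-- Truth in all APE-models. -/
def Valid (φ : Formula Ag At) : Prop :=
  ∀ M : Model.{u, v, w} Ag At, M.IsAPE → interp φ M = ⊤

/-- The semantic counterpart of well-formedness: the event structures that occur in the formula
satisfy the semantic conditions in all APE-models. -/
def Formula.SemWF : Formula Ag At → Prop
  | .atom _ => True
  | .bot => True
  | .and φ ψ => φ.SemWF ∧ ψ.SemWF
  | .or φ ψ => φ.SemWF ∧ ψ.SemWF
  | .imp φ ψ => φ.SemWF ∧ ψ.SemWF
  | .dia _ φ => φ.SemWF
  | .box _ φ => φ.SemWF
  | .evDia F Φ sub _ φ => ((∀ k, (Φ k).SemWF) ∧ (∀ e p, (sub e p).SemWF) ∧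
      ∀ M : Model.{u, v, w} Ag At, M.IsAPE → Coherent M F fun k => interp (Φ k) M) ∧ φ.SemWF
  | .evBox F Φ sub _ φ => ((∀ k, (Φ k).SemWF) ∧ (∀ e p, (sub e p).SemWF) ∧
      ∀ M : Model.{u, v, w} Ag At, M.IsAPE → Coherent M F fun k => interp (Φ k) M) ∧ φ.SemWF
  | .prob _ _ _ φ _ => ∀ k, (φ k).SemWF

/-- The semantic conditions on an event structure. -/
def EventStr.SemWF (E : EventStr Ag At) : Prop :=
  (∀ k, Formula.SemWF.{u, v, w} (E.Φ k)) ∧ (∀ e p, Formula.SemWF.{u, v, w} (E.sub e p)) ∧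
    ∀ M : Model.{u, v, w} Ag At, M.IsAPE → Coherent M E.frame (interpΦ M E)

theorem semWF_of_dBox_iff {E : EventStr Ag At} {e : Fin E.frame.n} {φ ψ : Formula Ag At}
    (h : Formula.SemWF.{u, v, w} (.iff (.dBox E e φ) ψ)) : EventStr.SemWF.{u, v, w} E :=
  h.1.1.1

theorem semWF_of_dDia_iff {E : EventStr Ag At} {e : Fin E.frame.n} {φ ψ : Formula Ag At}
    (h : Formula.SemWF.{u, v, w} (.iff (.dDia E e φ) ψ)) : EventStr.SemWF.{u, v, w} E :=
  h.1.1.1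

/-- Replacement of equivalents does not change the interpretation. -/
theorem interp_eq_of_repl {A B φ φ' : Formula Ag At}
    (hAB : Valid.{u, v, w} (.iff A B)) (h : Repl A B φ φ') (hφ : Formula.SemWF.{u, v, w} φ)
    (M : Model.{u, v, w} Ag At) (hM : M.IsAPE) : interp φ M = interp φ' M := by
  induction h generalizing M with
  | here => exact interp_iff_eq_top.1 (hAB M hM)
  | refl => rfl
  | and _ _ ih ih' => exact congrArg₂ (· ⊓ ·) (ih hφ.1 M hM) (ih' hφ.2 M hM)
  | or _ _ ih ih' => exact congrArg₂ (· ⊔ ·) (ih hφ.1 M hM) (ih' hφ.2 M hM)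
  | imp _ _ ih ih' => exact congrArg₂ (· ⇨ ·) (ih hφ.1 M hM) (ih' hφ.2 M hM)
  | dia _ ih => exact congrArg (M.dia _) (ih hφ M hM)
  | box _ ih => exact congrArg (M.box _) (ih hφ M hM)
  | @evDia F Φ Φ' sub sub' e φ φ' _ _ _ ihΦ ihs ih =>
    have h1 : (fun k => interp (Φ k) M) = fun k => interp (Φ' k) M :=
      funext fun k => ihΦ k (hφ.1.1 k) M hM
    have h2 : (fun e p => interp (sub e p) M) = fun e p => interp (sub' e p) M :=
      funext fun e => funext fun p => ihs e p (hφ.1.2.1 e p) M hM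
    -- The induction hypothesis is used at the updated model, which is an APE-model by the semantic
    -- conditions; `h1` and `h2` then identify the two updates.
    have h3 := ih hφ.2 _ (hM.update (hφ.1.2.2 M hM) fun e p => interp (sub e p) M)
    simp only [interp]
    rw [h3, h1, h2]
  | @evBox F Φ Φ' sub sub' e φ φ' _ _ _ ihΦ ihs ih =>
    have h1 : (fun k => interp (Φ k) M) = fun k => interp (Φ' k) M :=
      funext fun k => ihΦ k (hφ.1.1 k) M hM
    have h2 : (fun e p => interp (sub e p) M) = fun e p => interp (sub' e p) M :=
      funext fun e => funext fun p => ihs e p (hφ.1.2.1 e p) M hM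
    have h3 := ih hφ.2 _ (hM.update (hφ.1.2.2 M hM) fun e p => interp (sub e p) M)
    simp only [interp]
    rw [h3, h1, h2]
  | prob _ ih =>
    simp only [interp]
    simp only [fun k => ih k (hφ k) M hM]

section Probability

variable {M : Model.{u, v, w} Ag At} {i : Ag} {t t' : LTerm Ag At}

open LTerm

theorem interp_ge_eq_top (hM : M.IsAPE) {β : ℝ}
    (h : ∀ a, IsMin (M.dia i) a → β ≤ t.value M i a) : interp (ge i t β) M = ⊤ :=
  hM.epistemic.minSup_eq_top h

theorem interp_geT_eq_top (hM : M.IsAPE)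
    (h : ∀ a, IsMin (M.dia i) a → t'.value M i a ≤ t.value M i a) :
    interp (geT i t t') M = ⊤ :=
  interp_ge_eq_top hM fun a ha => by
    rw [value_add, value_neg, ← sub_eq_add_neg, sub_nonneg]
    exact h a ha

theorem interp_eqT_eq_top (hM : M.IsAPE)
    (h : ∀ a, IsMin (M.dia i) a → t.value M i a = t'.value M i a) :
    interp (eqT i t t') M = ⊤ :=
  inf_eq_top_iff.2 ⟨interp_geT_eq_top hM fun a ha => (h a ha).ge,
    interp_geT_eq_top hM fun a ha => (h a ha).le⟩

theorem interp_eq_eq_top (hM : M.IsAPE) {β : ℝ}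
    (h : ∀ a, IsMin (M.dia i) a → t.value M i a = β) : interp (eq i t β) M = ⊤ :=
  inf_eq_top_iff.2 ⟨interp_ge_eq_top hM fun a ha => (h a ha).ge,
    interp_ge_eq_top hM fun a ha => by rw [value_neg, h a ha]⟩

theorem le_interp_eqT {a : M.carrier} (ha : IsMin (M.dia i) a)
    (h : t.value M i a = t'.value M i a) : a ≤ interp (eqT i t t') M :=
  le_inf
    (le_minSup ha (by change 0 ≤ value M i _ a; rw [value_add, value_neg, h, add_neg_cancel]))
    (le_minSup ha (by change 0 ≤ value M i _ a; rw [value_add, value_neg, h, add_neg_cancel]))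

/-- If either inequality failed at `a`, the corresponding conjunct would be disjoint from `a`. -/
theorem value_eq_of_le_interp_eqT (hM : M.IsAPE) {a : M.carrier} (ha : IsMin (M.dia i) a)
    (hne : a ⊓ interp (eqT i t t') M ≠ ⊥) : t.value M i a = t'.value M i a := by
  have key : ∀ s s' : LTerm Ag At, interp (eqT i t t') M ≤ interp (geT i s s') M →
      s'.value M i a ≤ s.value M i a := fun s s' hle => by
    by_contra hn
    refine hne (le_bot_iff.1 ((inf_le_inf_left a hle).trans
      (hM.epistemic.isMin_inf_minSup ha ?_).le))
    change ¬ 0 ≤ value M i _ a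
    rwa [value_add, value_neg, ← sub_eq_add_neg, sub_nonneg]
  exact le_antisymm (key _ _ inf_le_right) (key _ _ inf_le_left)

/-- Test below each minimal `a`, which a boxed element either contains or misses. From left to
right, `φ ⊓ a ≤ ψ ⊓ a` with equal measures forces equality by strictness of the measure; conversely,
equivalence below `a` makes the two meets equal. -/
theorem interp_box_imp_eqT (hM : M.IsAPE) (φ ψ : Formula Ag At) :
    interp (.and (.box i (.imp φ ψ)) (eqT i (.mu φ) (.mu ψ))) M =
      interp (.box i (.iff ψ φ)) M := by
  have hE := hM.epistemic
  change M.box i (interp φ M ⇨ interp ψ M) ⊓ interp (eqT i (.mu φ) (.mu ψ)) M =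
    M.box i ((interp ψ M ⇨ interp φ M) ⊓ (interp φ M ⇨ interp ψ M))
  refine le_antisymm (hE.le_of_isMin i fun a ha => ?_)
    (le_inf (hE.box_mono i inf_le_right) (hE.le_of_isMin i fun a ha => ?_))
  · by_cases hne : a ⊓ interp (eqT i (.mu φ) (.mu ψ)) M = ⊥
    · exact (le_inf inf_le_right (inf_le_left.trans inf_le_right)).trans (hne.le.trans bot_le)
    have hval := value_eq_of_le_interp_eqT hM ha hne
    rw [value_mu, value_mu] at hval
    rcases hE.isMin_inf ha (hE.dia_box i (interp φ M ⇨ interp ψ M)) with hb | hb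
    · exact (le_inf inf_le_right (inf_le_left.trans inf_le_left)).trans (hb.le.trans bot_le)
    · refine inf_le_right.trans ((hE.le_box_iff ha.2.1).2 ?_)
      have hle := (hE.le_box_iff ha.2.1).1 hb
      refine le_inf ?_ hle
      rw [le_himp_iff, inf_comm] at hle ⊢
      have hsub : interp φ M ⊓ a ≤ interp ψ M ⊓ a := le_inf hle inf_le_right
      have heq : interp φ M ⊓ a = interp ψ M ⊓ a := by
        by_contra hn
        exact ((hM.measure i).strict a ha _ _ (hsub.lt_of_ne hn) inf_le_right).ne hval
      exact heq.ge.trans inf_le_left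
  · rcases hE.isMin_inf ha (hE.dia_box i
      ((interp ψ M ⇨ interp φ M) ⊓ (interp φ M ⇨ interp ψ M))) with hb | hb
    · rw [inf_comm, hb]
      exact bot_le
    · refine inf_le_right.trans (le_interp_eqT ha ?_)
      have hle := (hE.le_box_iff ha.2.1).1 hb
      rw [le_inf_iff, le_himp_iff, le_himp_iff, inf_comm, inf_comm a] at hle
      rw [value_mu, value_mu, le_antisymm (le_inf hle.2 inf_le_right) (le_inf hle.1 inf_le_right)]

end Probability

/-- Every axiom whose event structures satisfy the semantic conditions is valid. -/
theorem valid_of_ax {φ : Formula Ag At} (h : Ax φ) (hφ : Formula.SemWF.{u, v, w} φ) :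
    Valid.{u, v, w} φ := by
  intro M hM
  have hE := hM.epistemic
  cases h with
  | h1 A B => exact himp_eq_top_iff.2 le_himp
  | h2 A B C =>
    refine himp_eq_top_iff.2 (le_himp_iff.2 (le_himp_iff.2 ?_))
    exact (le_inf ((inf_le_inf_right _ inf_le_left).trans himp_inf_le)
        ((inf_le_inf_right _ inf_le_right).trans himp_inf_le)).trans himp_inf_le
  | h3 A B => exact himp_eq_top_iff.2 (le_himp_iff.2 le_rfl)
  | h4 A B C =>
    refine himp_eq_top_iff.2 (le_himp_iff.2 ?_)
    exact (sup_himp_distrib _ _ _).ge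
  | h5 A B => exact himp_eq_top_iff.2 inf_le_left
  | h6 A B => exact himp_eq_top_iff.2 inf_le_right
  | h7 A B => exact himp_eq_top_iff.2 le_sup_left
  | h8 A B => exact himp_eq_top_iff.2 le_sup_right
  | h9 A => exact himp_eq_top_iff.2 bot_le
  | m1 i A => exact himp_eq_top_iff.2 (hE.m1 i _)
  | m2 i A => exact himp_eq_top_iff.2 (hE.m2 i _)
  | m3 i A B => exact himp_eq_top_iff.2 (hE.m3 i _ _)
  | m4 i A B => exact himp_eq_top_iff.2 (hE.m4 i _ _)
  | m5 i A => exact himp_eq_top_iff.2 (hE.m5 i _)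
  | m6 i A => exact himp_eq_top_iff.2 (hE.m6 i _)
  | m7 i A B => exact himp_eq_top_iff.2 (hE.m7 i _ _)
  | e i A =>
    have := hE.e i (interp A M)
    rwa [← himp_bot] at this
  | n0 i t => exact interp_geT_eq_top hM fun _ _ => le_rfl
  | n1 i t β φ =>
    refine interp_iff_eq_top.2 ?_
    simp only [LTerm.interp_ge, LTerm.value_add, LTerm.value_single, zero_mul, add_zero]
  | n2 i n α φ β σ =>
    refine himp_eq_top_iff.2 (minSup_mono fun a _ hQ => hQ.trans_eq ?_)
    exact (Equiv.sum_comp σ fun k => α k * M.mu i (interp (φ k) M ⊓ a)).symm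
  | n3 i n α α' φ β β' =>
    refine himp_eq_top_iff.2 (hE.minSup_inf_le fun a _ hQ hR => ?_)
    simp only [add_mul, Finset.sum_add_distrib]
    exact add_le_add hQ hR
  | n4 i t β d =>
    refine himp_eq_top_iff.2 (hE.minSup_inf_le fun a _ hQ hR => ?_)
    -- The number inequality is encoded as an empty sum with bound `-d`, and the empty sum has value
    -- `0`.
    have hd : 0 ≤ d := by
      have := hR.trans_eq (LTerm.value_zero (M := M) i a)
      linarith
    exact (mul_le_mul_of_nonneg_left hQ hd).trans_eq (LTerm.value_smul i a d t).symm
  | n5 i t β =>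
    refine hE.minSup_sup_eq_top fun a _ => ?_
    refine (le_total β (t.value M i a)).imp id fun h => ?_
    exact (neg_le_neg h).trans_eq (LTerm.value_neg i a t).symm
  | n6 i t β γ h =>
    refine himp_eq_top_iff.2 (le_himp_iff.2 ?_)
    -- No minimal element satisfies both inequalities, so their meet is below an empty join.
    refine (hE.minSup_inf_le (S := fun _ => False) fun a _ hQ hR => ?_).trans
      (minSup_le fun _ _ h => h.elim)
    have h1 : β ≤ t.value M i a := hQ
    have h2 := hR.trans_eq (LTerm.value_neg i a t)
    linarith
  | p1 i =>
    refine interp_eq_eq_top hM fun a ha => ?_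
    rw [LTerm.value_mu]
    exact (congrArg _ (bot_inf_eq a)).trans ((hM.measure i).bot ⟨a, ha⟩)
  | p2 i =>
    refine interp_eq_eq_top hM fun a ha => ?_
    rw [LTerm.value_mu, interp_top, top_inf_eq, (hM.measure i).one a ha]
  | p3 i φ ψ =>
    refine interp_eqT_eq_top hM fun a ha => ?_
    simp only [LTerm.value_add, LTerm.value_mu, interp]
    rw [inf_sup_right, (hM.measure i).join a ha _ _ inf_le_right inf_le_right,
      ← inf_inf_distrib_right]
    ring
  | p4 i φ ψ => exact interp_iff_eq_top.2 (interp_box_imp_eqT hM φ ψ)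
  | p5 i n α φ β =>
    exact himp_eq_top_iff.2 ((hE.le_box_iff (hE.minSup_fixed i _)).2 le_rfl)
  | i1 E e p =>
    refine interp_iff_eq_top.2 ?_
    simp only [interp, interp_dBox, interp_preF, ev_atom]
    rw [himp_inf_distrib, himp_self, inf_top_eq]
  | i2 E e p =>
    refine interp_iff_eq_top.2 ?_
    simp only [interp, interp_dDia, interp_preF, ev_atom, inf_comm]
  | i3 E e =>
    refine interp_iff_eq_top.2 ?_
    rw [interp_dBox, ev_top, himp_self, interp_top]
  | i4 E e =>
    refine interp_iff_eq_top.2 ?_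
    rw [interp_dDia, ev_top, interp_preF]
  | i5 E e =>
    refine interp_iff_eq_top.2 ?_
    simp only [Formula.neg, interp, interp_dBox, ev_bot, interp_preF]
  | i6 E e =>
    refine interp_iff_eq_top.2 ?_
    simp only [interp, interp_dDia, ev_bot]
  | i7 E e φ ψ =>
    refine interp_iff_eq_top.2 ?_
    simp only [interp, interp_dBox, ev_and, himp_inf_distrib]
  | i8 E e φ ψ =>
    refine interp_iff_eq_top.2 ?_
    simp only [interp, interp_dDia, ev_and]
  | i9 E e φ ψ =>
    refine interp_iff_eq_top.2 ?_
    simp only [interp, interp_dBox, interp_dDia, ev_or, interp_preF]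
  | i10 E e φ ψ =>
    refine interp_iff_eq_top.2 ?_
    simp only [interp, interp_dDia, ev_or]
  | i11 E e φ ψ =>
    refine interp_iff_eq_top.2 ?_
    simp only [interp, interp_dBox, interp_dDia, ev_imp]
    -- After currying, the precondition is absorbed by the antecedent, whose representative lies
    -- below it.
    rw [himp_inf_distrib, himp_self, inf_top_eq, himp_himp, inf_eq_right.2 (ev_le φ e)]
  | i12 E e φ ψ =>
    refine interp_iff_eq_top.2 ?_
    simp only [interp, interp_dDia, ev_imp, interp_preF, inf_comm]
  | i13 E e i ψ =>
    refine interp_iff_eq_top.2 ?_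
    simp only [interp, interp_dBox, ev_dia, interp_preF, interp_bigOr_cell]
    rw [himp_inf_distrib, himp_self, inf_top_eq]
  | i14 E e i ψ =>
    refine interp_iff_eq_top.2 ?_
    simp only [interp, interp_dDia, ev_dia, interp_preF, interp_bigOr_cell, inf_comm]
  | i15 E e i ψ =>
    refine interp_iff_eq_top.2 ?_
    simp only [interp, interp_dBox, ev_box, interp_preF, interp_bigAnd_cell]
    rw [himp_inf_distrib, himp_self, inf_top_eq]
  | i16 E e i ψ =>
    refine interp_iff_eq_top.2 ?_
    simp only [interp, interp_dDia, ev_box, interp_preF, interp_bigAnd_cell, inf_comm]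
  | i17 E e i ψ α β =>
    refine interp_iff_eq_top.2 ?_
    have hΦ := (semWF_of_dBox_iff hφ).2.2 M hM
    simp only [interp, interp_dBox, ev_ge hM hΦ, interp_preF]
    rw [himp_inf_distrib, himp_self, top_inf_eq]
  | i18 E e i ψ α β =>
    refine interp_iff_eq_top.2 ?_
    have hΦ := (semWF_of_dDia_iff hφ).2.2 M hM
    simp only [interp, interp_dDia, ev_ge hM hΦ, interp_preF]

/-- Soundness: derivable formulas are valid in all APE-models. -/
theorem valid_of_provable {φ : Formula Ag At} (h : Provable φ) : Valid.{u, v, w} φ := by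
  refine Provable.rec (motive_1 := fun φ _ => Formula.SemWF.{u, v, w} φ)
    (motive_2 := fun E _ => EventStr.SemWF.{u, v, w} E)
    (motive_3 := fun φ _ => Valid.{u, v, w} φ)
    (fun _ => trivial) trivial (fun _ _ h h' => ⟨h, h'⟩) (fun _ _ h h' => ⟨h, h'⟩)
    (fun _ _ h h' => ⟨h, h'⟩) (fun _ h => h) (fun _ h => h) (fun _ _ h h' => ⟨h, h'⟩)
    (fun _ _ h h' => ⟨h, h'⟩) (fun _ h => h) ?_ (fun hax _ h => valid_of_ax hax h)
    ?_ ?_ ?_ ?_ ?_ h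
  · intro E _ _ _ _ _ _ hΦ hsub hle hdis
    -- Coherence is the semantic content of the derivability conditions on `Φ`, whose validity is
    -- part of the simultaneous induction.
    refine ⟨hΦ, hsub, fun M hM => ⟨fun k l hkl => himp_eq_top_iff.1 (hle k l hkl M hM), ?_⟩⟩
    exact fun k l hne h h' => le_bot_iff.1 (himp_eq_top_iff.1 (hdis k l hne h h' M hM))
  · intro A B _ _ hAB hA M hM
    have := himp_eq_top_iff.1 (hAB M hM)
    rwa [hA M hM, top_le_iff] at this
  · intro A i _ hA M hM
    change M.box i (interp A M) = ⊤
    rw [hA M hM, hM.epistemic.box_top]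
  · intro A E e _ _ hE hA M hM
    -- Necessitation for events needs validity of `A` in the updated model, not in `M`.
    have hupd := hA (updE M E) (hM.update (hE.2.2 M hM) _)
    have hev : ev M E A e = ev M E .top e := by rw [ev, ev, evClass, evClass, hupd, interp_top]
    rw [interp_dBox, hev, ev_top, himp_self]
  · intro A B i _ hAB M hM
    refine interp_geT_eq_top hM fun a ha => ?_
    rw [LTerm.value_mu, LTerm.value_mu]
    exact (hM.measure i).mono a ha _ _
      (inf_le_inf_right a (himp_eq_top_iff.1 (hAB M hM))) inf_le_right
  · intro A B φ φ' _ _ _ hrepl hAB hφ _ M hM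
    exact interp_iff_eq_top.2 (interp_eq_of_repl hAB hrepl hφ M hM)

end IPDEL

theorem mainTheorem2 {Ag : Type u} {At : Type v} (φ : IPDEL.Formula Ag At)
    (hφ : IPDEL.Provable φ) (M : IPDEL.Model.{u, v, w} Ag At) (hM : M.IsAPE) :
    IPDEL.Model.interp φ M = ⊤ :=
  IPDEL.valid_of_provable hφ M hM
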